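/- Let $p$ be a prime, $\mathbb{F}_q$ a finite field of characteristic $p$, $\mathbb{Z}_q=W(\mathbb{F}_q)$ its ring of Witt vectors, and $\mathbb{Q}_q=\operatorname{Frac}(\mathbb{Z}_q)$. Let $\overline F\in\mathbb{F}_q[x]$ be a squarefree polynomial of degree $d$, let $F\in\mathbb{Z}_q[x]$ be a lift of $\overline F$, also of degree $d$, let $r\ge 1$ be an integer, and put $\varepsilon=0$ if $\gcd(r,d)=1$ and $\varepsilon=1$ otherwise. Let $A^\dagger$ be the weak completion of $A=\mathbb{Z}_q[x,y,y^{-1}]/(y^r-F(x))$, i.e. the ring of power series in $x,y,y^{-1}$ over $\mathbb{Z}_q$ with radius of convergence greater than one, modulo the relations $y\cdot y^{-1}=1$ and $y^r=F(x)$. Let $\Omega$ be its module of continuous differentials (generated by $\mathrm{d}x,\mathrm{d}y,\mathrm{d}(y^{-1})$ subject to the differentials of the relations), and let $H^1_{\mathrm{MW}}=(\Omega/\mathrm{d}A^\dagger)\otimes_{\mathbb{Z}_q}\mathbb{Q}_q$. Let $\sigma$ be the Frobenius lift on $A^\dagger$ that acts on $\mathbb{Z}_q$ as the Witt vector Frobenius,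 with $\sigma(x)=x^p$ and $$\sigma(y^{-j})=y^{-jp}\sum_{k\ge 0}\binom{-j/r}{k}\bigl(\sigma(F(x))-F(x)^p\bigr)^k y^{-kpr},$$ extended to differentials by $\sigma(f\,\mathrm{d}g)=\sigma(f)\,\mathrm{d}(\sigma(g))$. (This is well defined whenever $p\nmid r$, which follows from the assumptions below.) Let $$B_\varepsilon=\{x^i y^{-(j+\varepsilon r)}\,\mathrm{d}x : 0\le i\le d-2,\ 1\le j\le r-1\}.$$ Let $N\ge 1$, $0\le i\le d-2$ and $\varepsilon r+1\le j\le(1+\varepsilon)r-1$ be integers (so that $x^iy^{-j}\,\mathrm{d}x\in B_\varepsilon$), and assume $p>d(N+\varepsilon)r$. For $0\le\ell<N$ and $0\le b\le d\ell$ put $$D_{j,\ell}=\sum_{k=\ell}^{N-1}(-1)^{k-\ell}\binom{-j/r}{k}\binom{k}{\ell},\qquad \mu_{j,\ell,b}=p\,D_{j,\ell}\,\sigma(F)^\ell_b,$$ where $\sigma(F)^\ell_b$ is the coefficient of $x^{pb}$ in $\sigma(F(x))^\ell$, and put $$T_{(i,j)}=x^{p(i+1)-1}y^{-jp}\sum_{\ell=0}^{N-1}\sum_{b=0}^{d\ell}\mu_{j,\ell,b}\,x^{pb}y^{-\ell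 pr}\,\mathrm{d}x.$$ Then the classes of $\sigma(x^iy^{-j}\,\mathrm{d}x)$ and $T_{(i,j)}$ in $H^1_{\mathrm{MW}}$ differ by an element of $p^N\operatorname{span}_{\mathbb{Z}_q}(B_\varepsilon)$. Moreover, the sum defining $T_{(i,j)}$ is indexed by $N+d\binom N2$ pairs $(\ell,b)$, a number that does not depend on $p$. -/

import Mathlib

set_option linter.unusedSectionVars false

namespace CyclicCover

section Overconvergent

variable (p : ℕ) {R : Type*} [CommRing R]

/-- A coefficient `c` in degree `n` is divisible by some `p ^ v` with `n ≤ a + b * v`. -/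
def CoeffBound (a b n : ℕ) (c : R) : Prop :=
  ∃ v : ℕ, n ≤ a + b * v ∧ (p : R) ^ v ∣ c

/-- The `p`-adic valuation of the coefficients of `f` grows at least linearly with the total
degree: `v_p (coeff s f) ≥ (|s| - a) / b` for every exponent `s`. -/
def GrowthBound (a b : ℕ) (f : MvPowerSeries (Fin 3) R) : Prop :=
  ∀ s : Fin 3 →₀ ℕ, CoeffBound p a b s.degree (MvPowerSeries.coeff s f)

/-- A power series is overconvergent (it converges on a polydisc of radius greater than one) if
the valuations of its coefficients grow at least linearly with the total degree. -/
def Overconvergent (f : MvPowerSeries (Fin 3) R) : Prop :=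
  ∃ a b : ℕ, GrowthBound p a b f

variable {p}

theorem CoeffBound.zero {a b n : ℕ} (hb : 0 < b) : CoeffBound p a b n (0 : R) :=
  ⟨n, by nlinarith, dvd_zero _⟩

theorem CoeffBound.mono {a b a' b' n : ℕ} {c : R} (ha : a ≤ a') (hb : b ≤ b')
    (h : CoeffBound p a b n c) : CoeffBound p a' b' n c := by
  obtain ⟨v, hv, hd⟩ := h
  exact ⟨v, hv.trans (Nat.add_le_add ha (Nat.mul_le_mul_right v hb)), hd⟩

theorem CoeffBound.add {a b n : ℕ} {c d : R} (hc : CoeffBound p a b n c)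
    (hd : CoeffBound p a b n d) : CoeffBound p a b n (c + d) := by
  obtain ⟨v, hv, hvd⟩ := hc
  obtain ⟨w, hw, hwd⟩ := hd
  rcases le_total v w with h | h
  · exact ⟨v, hv, dvd_add hvd ((pow_dvd_pow _ h).trans hwd)⟩
  · exact ⟨w, hw, dvd_add ((pow_dvd_pow _ h).trans hvd) hwd⟩

theorem CoeffBound.mul_left {a b n : ℕ} {c : R} (hc : CoeffBound p a b n c) (d : R) :
    CoeffBound p a b n (d * c) := by
  obtain ⟨v, hv, hvd⟩ := hc
  exact ⟨v, hv, hvd.mul_left d⟩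

theorem CoeffBound.sum {ι : Type*} {a b n : ℕ} (hb : 0 < b) {t : Finset ι} {c : ι → R}
    (h : ∀ i ∈ t, CoeffBound p a b n (c i)) : CoeffBound p a b n (∑ i ∈ t, c i) :=
  Finset.sum_induction c (CoeffBound p a b n) (fun _ _ => CoeffBound.add) (CoeffBound.zero hb) h

theorem CoeffBound.finsum {ι : Type*} {a b n : ℕ} (hb : 0 < b) {c : ι → R}
    (h : ∀ i, CoeffBound p a b n (c i)) : CoeffBound p a b n (∑ᶠ i, c i) :=
  finsum_induction (CoeffBound p a b n) (CoeffBound.zero hb) (fun _ _ => CoeffBound.add) h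

theorem GrowthBound.mono {a b a' b' : ℕ} {f : MvPowerSeries (Fin 3) R} (ha : a ≤ a') (hb : b ≤ b')
    (h : GrowthBound p a b f) : GrowthBound p a' b' f :=
  fun s => (h s).mono ha hb

theorem GrowthBound.mul {a₁ a₂ b : ℕ} (hb : 0 < b) {f g : MvPowerSeries (Fin 3) R}
    (hf : GrowthBound p a₁ b f) (hg : GrowthBound p a₂ b g) :
    GrowthBound p (a₁ + a₂) b (f * g) := by
  classical
  intro s
  rw [MvPowerSeries.coeff_mul]
  refine CoeffBound.sum hb fun i hi => ?_
  obtain ⟨v, hv, hvd⟩ := hf i.1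
  obtain ⟨w, hw, hwd⟩ := hg i.2
  refine ⟨v + w, ?_, ?_⟩
  · rw [← Finset.HasAntidiagonal.mem_antidiagonal.1 hi, map_add, mul_add]
    omega
  · rw [pow_add]
    exact mul_dvd_mul hvd hwd

theorem GrowthBound.one {b : ℕ} (hb : 0 < b) :
    GrowthBound p 0 b (1 : MvPowerSeries (Fin 3) R) := by
  classical
  intro s
  rw [MvPowerSeries.coeff_one]
  split_ifs with h
  · exact ⟨0, by simp [h], by simp⟩
  · exact CoeffBound.zero hb

theorem GrowthBound.pow {a b : ℕ} (hb : 0 < b) {f : MvPowerSeries (Fin 3) R}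
    (hf : GrowthBound p a b f) (n : ℕ) : GrowthBound p (n * a) b (f ^ n) := by
  induction n with
  | zero => simpa using GrowthBound.one hb
  | succ n ih =>
    rw [pow_succ, Nat.succ_mul]
    exact ih.mul hb hf

theorem GrowthBound.prod {b : ℕ} (hb : 0 < b) {a : Fin 3 → ℕ}
    {f : Fin 3 → MvPowerSeries (Fin 3) R} (t : Finset (Fin 3))
    (hf : ∀ i, GrowthBound p (a i) b (f i)) :
    GrowthBound p (∑ i ∈ t, a i) b (∏ i ∈ t, f i) := by
  classical
  induction t using Finset.induction_on with
  | empty => simpa using GrowthBound.one hb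
  | insert i t hi ih =>
    rw [Finset.prod_insert hi, Finset.sum_insert hi]
    exact (hf i).mul hb ih

theorem Overconvergent.exists_bound {f : MvPowerSeries (Fin 3) R} (hf : Overconvergent p f) :
    ∃ a b : ℕ, 0 < b ∧ GrowthBound p a b f := by
  obtain ⟨a, b, h⟩ := hf
  exact ⟨a, b + 1, b.succ_pos, h.mono le_rfl b.le_succ⟩

theorem Overconvergent.mul {f g : MvPowerSeries (Fin 3) R} (hf : Overconvergent p f)
    (hg : Overconvergent p g) : Overconvergent p (f * g) := by
  obtain ⟨a, b, hb, h⟩ := hf.exists_bound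
  obtain ⟨a', b', hb', h'⟩ := hg.exists_bound
  exact ⟨_, b + b', (h.mono le_rfl (Nat.le_add_right _ _)).mul (by omega)
    (h'.mono le_rfl (Nat.le_add_left _ _))⟩

theorem Overconvergent.add {f g : MvPowerSeries (Fin 3) R} (hf : Overconvergent p f)
    (hg : Overconvergent p g) : Overconvergent p (f + g) := by
  obtain ⟨a, b, h⟩ := hf
  obtain ⟨a', b', h'⟩ := hg
  refine ⟨a + a', b + b', fun s => ?_⟩
  rw [map_add]
  exact ((h s).mono (Nat.le_add_right _ _) (Nat.le_add_right _ _)).add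
    ((h' s).mono (Nat.le_add_left _ _) (Nat.le_add_left _ _))

theorem Overconvergent.algebraMap (c : R) :
    Overconvergent p (algebraMap R (MvPowerSeries (Fin 3) R) c) := by
  classical
  refine ⟨0, 1, fun s => ?_⟩
  rw [MvPowerSeries.algebraMap_apply, MvPowerSeries.coeff_C]
  split_ifs with h
  · exact ⟨0, by simp [h], by simp⟩
  · exact CoeffBound.zero one_pos

theorem Overconvergent.X (i : Fin 3) : Overconvergent p (MvPowerSeries.X i (R := R)) := by
  classical
  refine ⟨1, 1, fun s => ?_⟩
  rw [MvPowerSeries.coeff_X]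
  split_ifs with h
  · exact ⟨0, by simp [h], by simp⟩
  · exact CoeffBound.zero one_pos

theorem Overconvergent.pderiv {f : MvPowerSeries (Fin 3) R} (hf : Overconvergent p f)
    (i : Fin 3) : Overconvergent p (MvPowerSeries.pderiv R i f) := by
  obtain ⟨a, b, h⟩ := hf
  refine ⟨a, b, fun s => ?_⟩
  rw [MvPowerSeries.coeff_pderiv]
  obtain ⟨v, hv, hd⟩ := h (s + Finsupp.single i 1)
  refine ⟨v, le_trans ?_ hv, hd.mul_right _⟩
  rw [map_add]
  exact Nat.le_add_right _ _

theorem Overconvergent.map {f : MvPowerSeries (Fin 3) R} (hf : Overconvergent p f)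
    (φ : R →+* R) : Overconvergent p (MvPowerSeries.map φ f) := by
  obtain ⟨a, b, h⟩ := hf
  refine ⟨a, b, fun s => ?_⟩
  obtain ⟨v, hv, hd⟩ := h s
  refine ⟨v, hv, ?_⟩
  rw [MvPowerSeries.coeff_map]
  simpa using map_dvd φ hd

/-- Substituting overconvergent series without constant term into an overconvergent series. -/
theorem Overconvergent.subst {f : MvPowerSeries (Fin 3) R} (hf : Overconvergent p f)
    {g : Fin 3 → MvPowerSeries (Fin 3) R} (hg : ∀ i, Overconvergent p (g i))
    (hs : MvPowerSeries.HasSubst g) : Overconvergent p (MvPowerSeries.subst g f) := by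
  choose a b h using hg
  obtain ⟨a', b', h'⟩ := hf
  set A := ∑ i, a i with hA
  set B := ∑ i, b i + 1 with hB
  have hBpos : 0 < B := Nat.succ_pos _
  have hgB : ∀ i, GrowthBound p A B (g i) := fun i =>
    (h i).mono (Finset.single_le_sum (fun _ _ => Nat.zero_le _) (Finset.mem_univ i))
      ((Finset.single_le_sum (f := b) (fun _ _ => Nat.zero_le _) (Finset.mem_univ i)).trans
        (Nat.le_succ _))
  refine ⟨a' * A, b' * A + B, fun e => ?_⟩
  rw [MvPowerSeries.coeff_subst hs]
  refine CoeffBound.finsum (by omega) fun d => ?_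
  have hprod : GrowthBound p (d.degree * A) B (d.prod fun i n => g i ^ n) := by
    have := GrowthBound.prod (p := p) hBpos d.support (fun i => (hgB i).pow hBpos (d i))
    rw [← Finset.sum_mul] at this
    exact this
  obtain ⟨v, hv, hvd⟩ := h' d
  obtain ⟨w, hw, hwd⟩ := hprod e
  refine ⟨v + w, ?_, ?_⟩
  · have h1 : d.degree * A ≤ (a' + b' * v) * A := Nat.mul_le_mul_right _ hv
    calc e.degree ≤ d.degree * A + B * w := hw
      _ ≤ (a' + b' * v) * A + B * w := Nat.add_le_add_right h1 _
      _ ≤ a' * A + (b' * A + B) * (v + w) := by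
        have h2 : 0 ≤ B * v := Nat.zero_le _
        have h3 : 0 ≤ b' * A * w := Nat.zero_le _
        nlinarith
  · rw [pow_add, smul_eq_mul]
    exact mul_dvd_mul hvd hwd

/-- Substituting `p` times an overconvergent series into a univariate power series. -/
theorem Overconvergent.powerSeries_subst {g : MvPowerSeries (Fin 3) R} (hg : Overconvergent p g)
    (φ : PowerSeries R) (hs : PowerSeries.HasSubst ((p : R) • g)) :
    Overconvergent p (PowerSeries.subst ((p : R) • g) φ) := by
  obtain ⟨a, b, hb, h⟩ := hg.exists_bound
  have h1 : GrowthBound p 0 (a + b) ((p : R) • g) := fun s => by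
    obtain ⟨v, hv, hd⟩ := h s
    refine ⟨v + 1, ?_, ?_⟩
    · nlinarith [Nat.zero_le (a * v)]
    · rw [pow_succ', MvPowerSeries.coeff_smul]
      exact mul_dvd_mul_left _ hd
  refine ⟨0, a + b, fun e => ?_⟩
  rw [PowerSeries.coeff_subst hs]
  refine CoeffBound.finsum (by omega) fun n => ?_
  rw [smul_eq_mul]
  exact CoeffBound.mul_left (by simpa using h1.pow (by omega) n e) _

variable (p R)

/-- The ring of overconvergent power series in the three variables `x`, `y`, `y⁻¹`
(numbered `0`, `1`, `2`) with coefficients in `R`. -/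
def overconvergentSeries : Subalgebra R (MvPowerSeries (Fin 3) R) where
  carrier := {f | Overconvergent p f}
  mul_mem' := Overconvergent.mul
  add_mem' := Overconvergent.add
  algebraMap_mem' := Overconvergent.algebraMap

/-- The variables `x`, `y`, `y⁻¹` as overconvergent series. -/
noncomputable def coord (i : Fin 3) : overconvergentSeries p R := ⟨MvPowerSeries.X i, Overconvergent.X i⟩

/-- The formal partial derivatives on overconvergent series. -/
noncomputable def partialDeriv (i : Fin 3) :
    overconvergentSeries p R →ₗ[R] overconvergentSeries p R :=
  ((MvPowerSeries.pderiv R i).toLinearMap.comp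
    (overconvergentSeries p R).val.toLinearMap).codRestrict
    (Subalgebra.toSubmodule (overconvergentSeries p R)) fun f => Overconvergent.pderiv f.2 i

end Overconvergent

section Dagger

variable (p : ℕ) {R : Type*} [CommRing R] (r : ℕ) (F : Polynomial R)

/-- The ideal of relations `y * y⁻¹ = 1` and `y ^ r = F(x)` among overconvergent series. -/
noncomputable def relations : Ideal (overconvergentSeries p R) :=
  Ideal.span {coord p R 1 * coord p R 2 - 1,
    coord p R 1 ^ r - Polynomial.aeval (coord p R 0) F}

/-- The weak completion `A†` of `A = R[x, y, y⁻¹] / (y ^ r - F(x))`. -/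
def Dagger : Type _ := overconvergentSeries p R ⧸ relations p r F

noncomputable instance : CommRing (Dagger p r F) :=
  inferInstanceAs (CommRing (overconvergentSeries p R ⧸ relations p r F))

noncomputable instance : Algebra R (Dagger p r F) :=
  inferInstanceAs (Algebra R (overconvergentSeries p R ⧸ relations p r F))

/-- The class in `A†` of an overconvergent series. -/
noncomputable def toDagger : overconvergentSeries p R →ₐ[R] Dagger p r F :=
  Ideal.Quotient.mkₐ R (relations p r F)

theorem toDagger_eq_iff {f g : overconvergentSeries p R} :
    toDagger p r F f = toDagger p r F g ↔ f - g ∈ relations p r F :=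
  Ideal.Quotient.eq

/-- The function `x` in `A†`. -/
noncomputable def xFun : Dagger p r F := toDagger p r F (coord p R 0)

/-- The function `y⁻¹` in `A†`. -/
noncomputable def yInv : Dagger p r F := toDagger p r F (coord p R 2)

/-- The total differential `∂₀f dx + ∂₁f dy + ∂₂f d(y⁻¹)` of an overconvergent series, with
coefficients read in `A†`. -/
noncomputable def gradient : overconvergentSeries p R →ₗ[R] (Fin 3 → Dagger p r F) :=
  LinearMap.pi fun i => (toDagger p r F).toLinearMap.comp (partialDeriv p R i)

/-- The submodule spanned by the differentials of all relations. -/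
noncomputable def relationForms : Submodule (Dagger p r F) (Fin 3 → Dagger p r F) :=
  Submodule.span (Dagger p r F) (gradient p r F '' (relations p r F : Set _))

/-- The module of (continuous) differentials of `A†`: the free module on `dx`, `dy`, `d(y⁻¹)`
modulo the differentials of all relations. -/
def Differentials : Type _ := (Fin 3 → Dagger p r F) ⧸ relationForms p r F

noncomputable instance : AddCommGroup (Differentials p r F) :=
  inferInstanceAs (AddCommGroup ((Fin 3 → Dagger p r F) ⧸ relationForms p r F))

noncomputable instance : Module (Dagger p r F) (Differentials p r F) :=
  inferInstanceAs (Module (Dagger p r F) ((Fin 3 → Dagger p r F) ⧸ relationForms p r F))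

noncomputable instance : Module R (Differentials p r F) :=
  inferInstanceAs (Module R ((Fin 3 → Dagger p r F) ⧸ relationForms p r F))

instance : IsScalarTower R (Dagger p r F) (Differentials p r F) :=
  inferInstanceAs (IsScalarTower R (Dagger p r F) ((Fin 3 → Dagger p r F) ⧸ relationForms p r F))

/-- The class of `f₀ dx + f₁ dy + f₂ d(y⁻¹)` in the module of differentials. -/
noncomputable def toDifferentials :
    (Fin 3 → Dagger p r F) →ₗ[Dagger p r F] Differentials p r F :=
  (relationForms p r F).mkQ

theorem toDifferentials_eq_zero_iff {v : Fin 3 → Dagger p r F} :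
    toDifferentials p r F v = 0 ↔ v ∈ relationForms p r F :=
  Submodule.Quotient.mk_eq_zero _

/-- The exterior derivative `d : A† → Ω`. -/
noncomputable def exteriorD : Dagger p r F →ₗ[R] Differentials p r F :=
  Submodule.liftQ ((relations p r F).restrictScalars R)
    (((toDifferentials p r F).restrictScalars R).comp (gradient p r F))
    fun f hf => (toDifferentials_eq_zero_iff p r F).2 (Submodule.subset_span ⟨f, hf, rfl⟩)

theorem exteriorD_toDagger (f : overconvergentSeries p R) :
    exteriorD p r F (toDagger p r F f) = toDifferentials p r F (gradient p r F f) :=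
  rfl

/-- The first Monsky--Washnitzer cohomology group: the cokernel of `d : A† → Ω`, with
coefficients extended to the fraction field of `R`. On a curve every one-form is closed. -/
abbrev MWCohomology [IsDomain R] : Type _ :=
  TensorProduct R (FractionRing R) (Differentials p r F ⧸ LinearMap.range (exteriorD p r F))

/-- The cohomology class of a differential. -/
noncomputable def cohomologyClass [IsDomain R] :
    Differentials p r F →ₗ[R] MWCohomology p r F :=
  (TensorProduct.mk R (FractionRing R)
    (Differentials p r F ⧸ LinearMap.range (exteriorD p r F)) 1).comp
    (Submodule.mkQ (LinearMap.range (exteriorD p r F)))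

end Dagger

section Frobenius

/-- `binom(-j / r, n)` as a `p`-adic integer, for `p` not dividing `r`. -/
noncomputable def binomPadic (p : ℕ) [Fact p.Prime] (r : ℕ) (j : ℤ) (n : ℕ) : ℤ_[p] :=
  Ring.choose (-(j : ℤ_[p]) * Ring.inverse (r : ℤ_[p])) n

variable (p : ℕ) [Fact p.Prime] (k : Type*) [Field k] [CharP k p]

/-- The inclusion `ℤ_p → ℤ_q`, where `ℤ_q` is the ring of Witt vectors of `k = 𝔽_q`. -/
noncomputable def padicToWitt : ℤ_[p] →+* WittVector p k :=
  (WittVector.map (ZMod.castHom (dvd_refl p) k)).comp (WittVector.equiv p).symm.toRingHom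

/-- The binomial series `(1 + T) ^ (-j / r) = ∑ₙ binom(-j / r, n) Tⁿ` over `ℤ_q`. -/
noncomputable def binomSeries (r : ℕ) (j : ℤ) : PowerSeries (WittVector p k) :=
  PowerSeries.mk fun n => padicToWitt p k (binomPadic p r j n)

variable {k}

/-- `σ(F(x))`: Frobenius acts on the coefficients, and `x` goes to `x ^ p`. -/
noncomputable def frobPoly (F : Polynomial (WittVector p k)) : Polynomial (WittVector p k) :=
  Polynomial.expand (WittVector p k) p (F.map WittVector.frobenius)

variable {p}

theorem binomSeries_eq (r : ℕ) (j : ℤ) : binomSeries p k r j =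
    PowerSeries.map (padicToWitt p k)
      (PowerSeries.binomialSeries ℤ_[p] (-(j : ℤ_[p]) * Ring.inverse (r : ℤ_[p]))) := by
  ext n : 1
  simp [binomSeries, binomPadic]

theorem binomSeries_zero (r : ℕ) : binomSeries p k r 0 = 1 := by
  simp [binomSeries_eq]

theorem binomSeries_add (r : ℕ) (i j : ℤ) :
    binomSeries p k r (i + j) = binomSeries p k r i * binomSeries p k r j := by
  simp only [binomSeries_eq, ← map_mul, ← PowerSeries.binomialSeries_add]
  congr 2
  push_cast
  ring

theorem binomSeries_nsmul (r : ℕ) (j : ℤ) (n : ℕ) :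
    binomSeries p k r (n * j) = binomSeries p k r j ^ n := by
  induction n with
  | zero => simp [binomSeries_zero]
  | succ n ih =>
    rw [pow_succ, ← ih, ← binomSeries_add]
    congr 1
    push_cast
    ring

theorem isUnit_natCast_padicInt {r : ℕ} (hr : ¬ p ∣ r) : IsUnit (r : ℤ_[p]) := by
  rw [PadicInt.isUnit_iff]
  exact PadicInt.norm_natCast_eq_one_iff.2 (((Nat.Prime.coprime_iff_not_dvd Fact.out).2 hr))

theorem binomSeries_neg {r : ℕ} (hr : ¬ p ∣ r) : binomSeries p k r (-r) = 1 + PowerSeries.X := by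
  have h : -((-(r : ℤ) : ℤ) : ℤ_[p]) * Ring.inverse (r : ℤ_[p]) = (1 : ℕ) := by
    push_cast
    rw [neg_neg, Ring.mul_inverse_cancel _ (isUnit_natCast_padicInt hr)]
  rw [binomSeries_eq, h, PowerSeries.binomialSeries_nat]
  simp

variable [Finite k]

theorem exists_frobPoly_sub_pow (F : Polynomial (WittVector p k)) :
    ∃ E : Polynomial (WittVector p k), frobPoly p F - F ^ p = (p : WittVector p k) • E := by
  have hp : p ≠ 0 := (Fact.out : p.Prime).ne_zero
  have h : (frobPoly p F - F ^ p).map WittVector.constantCoeff = 0 := by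
    have h1 : (WittVector.constantCoeff : WittVector p k →+* k).comp WittVector.frobenius =
        (frobenius k p).comp WittVector.constantCoeff := by
      ext w
      simp [WittVector.constantCoeff_apply, WittVector.coeff_frobenius_charP, frobenius_def]
    rw [Polynomial.map_sub, Polynomial.map_pow, frobPoly, Polynomial.map_expand,
      Polynomial.map_map, h1, ← Polynomial.map_map, ← Polynomial.map_expand,
      Polynomial.map_frobenius_expand, sub_self]
  have h2 : (Polynomial.C (p : WittVector p k)) ∣ frobPoly p F - F ^ p := by
    rw [Polynomial.C_dvd_iff_dvd_coeff]
    intro n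
    rw [← Ideal.mem_span_singleton, ← WittVector.ker_constantCoeff, RingHom.mem_ker,
      ← Polynomial.coeff_map, h, Polynomial.coeff_zero]
  obtain ⟨E, hE⟩ := h2
  exact ⟨E, by rw [hE, Polynomial.smul_eq_C_mul]⟩

variable (F : Polynomial (WittVector p k)) (r : ℕ)

/-- The series `(σ(F(x)) - F(x) ^ p) * y ^ (-p * r)`. -/
noncomputable def frobCorrection : overconvergentSeries p (WittVector p k) :=
  Polynomial.aeval (coord p _ 0) (frobPoly p F - F ^ p) * coord p _ 2 ^ (p * r)

theorem exists_frobCorrection_eq :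
    ∃ g : MvPowerSeries (Fin 3) (WittVector p k), Overconvergent p g ∧
      (frobCorrection F r : MvPowerSeries (Fin 3) (WittVector p k)) =
        (p : WittVector p k) • g := by
  obtain ⟨E, hE⟩ := exists_frobPoly_sub_pow F
  refine ⟨_, (Polynomial.aeval (coord p _ 0) E * coord p _ 2 ^ (p * r)).2, ?_⟩
  rw [frobCorrection, hE, map_smul, smul_mul_assoc]
  rfl

theorem hasSubst_frobCorrection (hr : 0 < r) :
    PowerSeries.HasSubst (frobCorrection F r : MvPowerSeries (Fin 3) (WittVector p k)) := by
  have hp : p ≠ 0 := (Fact.out : p.Prime).ne_zero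
  apply PowerSeries.HasSubst.of_constantCoeff_zero
  simp [frobCorrection, coord, hp, hr.ne']

/-- The series `∑ₙ binom(-j / r, n) (σ(F(x)) - F(x) ^ p) ^ n y ^ (-n * p * r)`. -/
noncomputable def frobUnit (hr : 0 < r) (j : ℤ) : overconvergentSeries p (WittVector p k) :=
  ⟨PowerSeries.subst (frobCorrection F r : MvPowerSeries (Fin 3) (WittVector p k))
    (binomSeries p k r j), by
    obtain ⟨g, hg, h⟩ := exists_frobCorrection_eq F r
    have hs := hasSubst_frobCorrection F r hr
    rw [h] at hs ⊢
    exact hg.powerSeries_subst _ hs⟩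

theorem frobUnit_zero (hr : 0 < r) : frobUnit F r hr 0 = 1 := by
  apply Subtype.ext
  have hs := hasSubst_frobCorrection F r hr
  simp only [frobUnit, binomSeries_zero, ← PowerSeries.coe_substAlgHom hs, map_one]
  rfl

theorem frobUnit_add (hr : 0 < r) (i j : ℤ) :
    frobUnit F r hr (i + j) = frobUnit F r hr i * frobUnit F r hr j := by
  apply Subtype.ext
  have hs := hasSubst_frobCorrection F r hr
  simp only [frobUnit, binomSeries_add, ← PowerSeries.coe_substAlgHom hs, map_mul]
  rfl

theorem frobUnit_nsmul (hr : 0 < r) (j : ℤ) (n : ℕ) :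
    frobUnit F r hr (n * j) = frobUnit F r hr j ^ n := by
  induction n with
  | zero => simp [frobUnit_zero]
  | succ n ih =>
    rw [pow_succ, ← ih, ← frobUnit_add]
    congr 1
    push_cast
    ring

theorem frobUnit_neg {r : ℕ} (hr : 0 < r) (hpr : ¬ p ∣ r) :
    frobUnit F r hr (-r) = 1 + frobCorrection F r := by
  apply Subtype.ext
  have hs := hasSubst_frobCorrection F r hr
  simp only [frobUnit, binomSeries_neg hpr, ← PowerSeries.coe_substAlgHom hs, map_add, map_one,
    PowerSeries.substAlgHom_X]
  rfl

/-- The images of `x`, `y`, `y⁻¹` under Frobenius: `x ↦ x ^ p`, and `y ^ (-j)` with `j = -1, 1`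
goes to `y ^ (-j * p) ∑ₙ binom(-j / r, n) (σ(F(x)) - F(x) ^ p) ^ n y ^ (-n * p * r)`. -/
noncomputable def frobCoord (hr : 0 < r) : Fin 3 → overconvergentSeries p (WittVector p k) :=
  ![coord p _ 0 ^ p, coord p _ 1 ^ p * frobUnit F r hr (-1),
    coord p _ 2 ^ p * frobUnit F r hr 1]

theorem hasSubst_frobCoord (hr : 0 < r) : MvPowerSeries.HasSubst
    fun i => (frobCoord F r hr i : MvPowerSeries (Fin 3) (WittVector p k)) := by
  have hp : p ≠ 0 := (Fact.out : p.Prime).ne_zero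
  refine MvPowerSeries.hasSubst_of_constantCoeff_zero fun i => ?_
  fin_cases i <;> simp [frobCoord, coord, hp]

/-- The Frobenius lift on overconvergent series: apply the Witt vector Frobenius to the
coefficients, and substitute the images of `x`, `y`, `y⁻¹`. -/
noncomputable def frobSeries (hr : 0 < r) :
    overconvergentSeries p (WittVector p k) →+* overconvergentSeries p (WittVector p k) :=
  ((MvPowerSeries.substAlgHom (R := WittVector p k) (hasSubst_frobCoord F r hr)).toRingHom.comp
    ((MvPowerSeries.map (σ := Fin 3)
      (WittVector.frobenius : WittVector p k →+* WittVector p k)).comp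
      (overconvergentSeries p (WittVector p k)).val.toRingHom)).codRestrict
    (overconvergentSeries p (WittVector p k)) fun f => by
      have h := (Overconvergent.map f.2 WittVector.frobenius).subst
        (fun i => (frobCoord F r hr i).2) (hasSubst_frobCoord F r hr)
      rw [← MvPowerSeries.coe_substAlgHom (hasSubst_frobCoord F r hr)] at h
      exact h

theorem frobSeries_coord (hr : 0 < r) (i : Fin 3) :
    frobSeries F r hr (coord p _ i) = frobCoord F r hr i := by
  apply Subtype.ext
  change MvPowerSeries.substAlgHom (hasSubst_frobCoord F r hr)
    (MvPowerSeries.map WittVector.frobenius (MvPowerSeries.X i)) = _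
  rw [MvPowerSeries.map_X, MvPowerSeries.substAlgHom_X]

theorem frobSeries_algebraMap (hr : 0 < r) (c : WittVector p k) :
    frobSeries F r hr (algebraMap _ _ c) =
      algebraMap _ (overconvergentSeries p (WittVector p k)) (WittVector.frobenius c) := by
  apply Subtype.ext
  change MvPowerSeries.substAlgHom (hasSubst_frobCoord F r hr)
    (MvPowerSeries.map WittVector.frobenius (algebraMap _ _ c)) = algebraMap _ _ _
  rw [MvPowerSeries.algebraMap_apply, MvPowerSeries.map_C, Algebra.algebraMap_self_apply,
    MvPowerSeries.substAlgHom_apply, MvPowerSeries.subst_C]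
  rfl

theorem frobSeries_aeval (hr : 0 < r) (G : Polynomial (WittVector p k)) :
    frobSeries F r hr (Polynomial.aeval (coord p _ 0) G) =
      Polynomial.aeval (coord p _ 0) (frobPoly p G) := by
  have h : ((frobSeries F r hr).comp (Polynomial.aeval (coord p _ 0)).toRingHom) =
      (Polynomial.aeval (coord p _ 0)).toRingHom.comp
        ((Polynomial.expand (WittVector p k) p).toRingHom.comp
          (Polynomial.mapRingHom WittVector.frobenius)) := by
    apply Polynomial.ringHom_ext
    · intro c
      simp [frobSeries_algebraMap]
    · simp [frobSeries_coord, frobCoord]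
  exact congrArg (fun f => f G) h

theorem relations_le_comap_frobSeries {r : ℕ} (hr : 0 < r) (hpr : ¬ p ∣ r) :
    relations p r F ≤ (relations p r F).comap (frobSeries F r hr) := by
  set x := coord p (WittVector p k) 0 with hx
  set z := coord p (WittVector p k) 2 with hz
  set X := toDagger p r F (Polynomial.aeval x F)
  set S := toDagger p r F (Polynomial.aeval x (frobPoly p F)) with hS
  set Y := toDagger p r F (coord p (WittVector p k) 1) with hY
  set Z := toDagger p r F z with hZ
  have hyz : Y * Z = 1 := by
    rw [hY, hZ, ← map_mul, ← map_one (toDagger p r F)]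
    exact (toDagger_eq_iff p r F).2 (Ideal.subset_span (Or.inl rfl))
  have hyF : Y ^ r = X := by
    rw [hY, ← map_pow]
    exact (toDagger_eq_iff p r F).2 (Ideal.subset_span (Or.inr rfl))
  refine Ideal.span_le.2 ?_
  rintro f (rfl | rfl)
  · rw [SetLike.mem_coe, Ideal.mem_comap, map_sub, map_mul, frobSeries_coord, frobSeries_coord,
      map_one, ← toDagger_eq_iff, map_one]
    have h : frobUnit F r hr (-1) * frobUnit F r hr 1 = 1 := by
      rw [← frobUnit_add, neg_add_cancel, frobUnit_zero]
    have h' : frobCoord F r hr 1 * frobCoord F r hr 2 =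
        (coord p (WittVector p k) 1 * coord p (WittVector p k) 2) ^ p := by
      simp only [frobCoord, Matrix.cons_val]
      rw [mul_mul_mul_comm, h, mul_one, mul_pow]
    rw [h', map_pow, map_mul, ← hY, ← hz, ← hZ, hyz, one_pow]
  · rw [SetLike.mem_coe, Ideal.mem_comap, map_sub, map_pow, frobSeries_coord, frobSeries_aeval,
      ← toDagger_eq_iff]
    have h' : frobCoord F r hr 1 ^ r =
        coord p (WittVector p k) 1 ^ (p * r) * (1 + frobCorrection F r) := by
      rw [← frobUnit_neg F hr hpr, show (-(r : ℤ)) = r * (-1) by ring, frobUnit_nsmul]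
      simp only [frobCoord, Matrix.cons_val]
      rw [mul_pow, ← pow_mul]
    have h1 : toDagger p r F (frobCorrection F r) = (S - X ^ p) * Z ^ (p * r) := by
      simp only [frobCorrection, map_mul, map_sub, map_pow]
      rfl
    have h3 : Y ^ (p * r) * Z ^ (p * r) = 1 :=
      (mul_pow Y Z (p * r)).symm.trans (by rw [hyz, one_pow])
    have h4 : Y ^ (p * r) = X ^ p := by
      rw [← hyF, ← pow_mul, mul_comm]
    rw [h', map_mul, map_add, map_one, map_pow, h1, ← hY, ← hx, ← hS]
    calc Y ^ (p * r) * (1 + (S - X ^ p) * Z ^ (p * r))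
        = Y ^ (p * r) + (S - X ^ p) * (Y ^ (p * r) * Z ^ (p * r)) := by ring
      _ = S := by rw [h3, h4]; ring

theorem pos_of_not_dvd {r : ℕ} (hpr : ¬ p ∣ r) : 0 < r :=
  Nat.pos_of_ne_zero fun h => hpr (h ▸ dvd_zero p)

/-- The Frobenius endomorphism `σ` of `A†`, semilinear over the Witt vector Frobenius. -/
noncomputable def frob {r : ℕ} (hpr : ¬ p ∣ r) : Dagger p r F →+* Dagger p r F :=
  Ideal.quotientMap _ (frobSeries F r (pos_of_not_dvd hpr))
    (relations_le_comap_frobSeries F (pos_of_not_dvd hpr) hpr)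

theorem frob_toDagger {r : ℕ} (hpr : ¬ p ∣ r) (f : overconvergentSeries p (WittVector p k)) :
    frob F hpr (toDagger p r F f) =
      toDagger p r F (frobSeries F r (pos_of_not_dvd hpr) f) :=
  rfl

theorem frob_algebraMap {r : ℕ} (hpr : ¬ p ∣ r) (c : WittVector p k) :
    frob F hpr (algebraMap _ _ c) = algebraMap _ _ (WittVector.frobenius c) := by
  rw [← AlgHom.commutes (toDagger p r F), frob_toDagger, frobSeries_algebraMap, AlgHom.commutes]

/-- The formula defining Frobenius:
`σ(y ^ (-j)) = y ^ (-j * p) ∑ₙ binom(-j / r, n) (σ(F(x)) - F(x) ^ p) ^ n y ^ (-n * p * r)`. -/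
theorem frob_yInv_pow {r : ℕ} (hpr : ¬ p ∣ r) (j : ℕ) :
    frob F hpr (yInv p r F ^ j) =
      yInv p r F ^ (j * p) * toDagger p r F (frobUnit F r (pos_of_not_dvd hpr) j) := by
  have h := frobUnit_nsmul F r (pos_of_not_dvd hpr) 1 j
  rw [mul_one] at h
  rw [h, map_pow, yInv, frob_toDagger, frobSeries_coord]
  simp only [frobCoord, Matrix.cons_val, map_mul, map_pow]
  rw [mul_pow, ← pow_mul, mul_comm p j]

/-- The Frobenius on differentials, `σ(f dg) = σ(f) d(σ(g))`. -/
noncomputable def frobForm {r : ℕ} (hpr : ¬ p ∣ r) (f g : Dagger p r F) : Differentials p r F :=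
  frob F hpr f • exteriorD p r F (frob F hpr g)

end Frobenius

section SparseFormula

/-- `ε = 0` if `gcd(r, d) = 1`, and `ε = 1` otherwise. -/
def eps (r d : ℕ) : ℕ := if Nat.gcd r d = 1 then 0 else 1

theorem not_dvd_of_bound {p r d N i j : ℕ} (hN : 0 < N) (hi : i + 2 ≤ d)
    (hj : j + 1 ≤ (1 + eps r d) * r) (hp : d * (N + eps r d) * r < p) : ¬ p ∣ r := by
  intro h
  have hr : 0 < r := Nat.pos_of_ne_zero fun h0 => by simp [h0] at hj
  have h1 : p ≤ r := Nat.le_of_dvd hr h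
  have h2 : 0 < d * (N + eps r d) := Nat.mul_pos (by omega) (by omega)
  have h3 : r ≤ d * (N + eps r d) * r := Nat.le_mul_of_pos_left r h2
  omega

/-- The pairs `(ℓ, b)` with `0 ≤ ℓ < N` and `0 ≤ b ≤ d * ℓ`. -/
def termIndex (N d : ℕ) : Finset (Σ _ : ℕ, ℕ) :=
  (Finset.range N).sigma fun l => Finset.range (d * l + 1)

variable (p : ℕ) [Fact p.Prime] {k : Type*} [Field k] [CharP k p]
  (F : Polynomial (WittVector p k)) (r : ℕ)

/-- The differential `x ^ i y ^ (-j) dx`. -/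
noncomputable def monomialForm (i j : ℕ) : Differentials p r F :=
  (xFun p r F ^ i * yInv p r F ^ j) • exteriorD p r F (xFun p r F)

/-- The set `B_ε` of the differentials `x ^ i y ^ (-(j + ε r)) dx` with `0 ≤ i ≤ d - 2` and
`1 ≤ j ≤ r - 1`. -/
def basisForms (d : ℕ) : Set (Differentials p r F) :=
  {ω | ∃ i j : ℕ, i + 2 ≤ d ∧ 1 ≤ j ∧ j + 1 ≤ r ∧ ω = monomialForm p F r i (j + eps r d * r)}

variable (k) in
/-- `D_{j,ℓ} = ∑_{m=ℓ}^{N-1} (-1)^(m-ℓ) binom(-j/r, m) binom(m, ℓ)`, an element of `ℤ_q`. -/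
noncomputable def coeffD (N j l : ℕ) : WittVector p k :=
  ∑ m ∈ Finset.Ico l N, (-1) ^ (m - l) * padicToWitt p k (binomPadic p r j m) * (m.choose l)

/-- `μ_{j,ℓ,b} = p D_{j,ℓ} σ(F)^ℓ_b`, with `σ(F)^ℓ_b` the coefficient of `x ^ (p b)` in
`σ(F(x)) ^ ℓ`. -/
noncomputable def coeffMu (N j l b : ℕ) : WittVector p k :=
  p * coeffD p k r N j l * (frobPoly p F ^ l).coeff (p * b)

/-- The sparse differential `T_{(i,j)}`. -/
noncomputable def sparseForm (d N i j : ℕ) : Differentials p r F :=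
  (xFun p r F ^ (p * (i + 1) - 1) * yInv p r F ^ (j * p) *
    ∑ t ∈ termIndex N d, coeffMu p F r N j t.1 t.2 •
      (xFun p r F ^ (p * t.2) * yInv p r F ^ (t.1 * p * r))) •
    exteriorD p r F (xFun p r F)

end SparseFormula

end CyclicCover

/-! Put `u = σ(F) y^(-pr) - 1`. By `frobForm_eq` and `sparseForm_eq`, both differentials are `p
x^(p(i+1)-1) y^(-jp) dx` times a series in `u`. For Frobenius it is the binomial series of `(1 +
u)^(-j/r)`; for the sparse form it is the truncation of that series at `u^N`, rewritten in powers of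
`1 + u`. Since `F^p y^(-pr) = 1` and `σ(F) ≡ F^p` mod `p`, one has `u = p E(x) y^(-pr)`. Hence the
`s`-th term of the tail is `p^(N+s+1)` times an integral form with pole order `pτ`, where `τ = j +
(N+s)r`. It remains to reduce these forms to the basis without losing more than the spare powers of
`p`.

Modulo exact forms, numerators change by values of `covDeriv`. Poles along `F = 0` are lowered by
`exists_dvd_sub_covDeriv`. It expands the numerator `F`-adically with digits that are constant
modulo a high power of `F`, so the denominators met at the successive pole orders do not multiply:
one common multiple suffices. These denominators are, up to units, positive integers below `pτ`, so
`p^L` suffices once `τ < p^L`.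

The degree in `x` is lowered from the top by `exists_natDegree_sub_covDeriv_lt`, at the cost of a
single `p`. Here the lower bound on `p` enters: by `criticalRange` the relevant integers are nonzero
and smaller than `p^2` in absolute value, and whenever one is divisible by `p` there is a primitive
that is a `p`-th power, whose differential is divisible by `p` (`exists_covDeriv_leading`).
`exists_eq_covDeriv_add` glues the two reductions, still at total cost `p^L`.

With `L = 1 + ⌈s/2⌉` the `s`-th term retains `p^(N + ⌊s/2⌋)`. Thus `p^N` factors out and `p^⌊s/2⌋`
remains for convergence. As the degrees of primitives grow linearly in `s`, the sum of primitives is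
overconvergent (`exists_overconvergent_reduction`). The summation is done with power series, keeping
track of the multiple of `F(x) z^r - 1`, and only the finished identity is pushed to `A†`. -/

namespace CyclicCover

/-! ### Reduction of pole order and degree, over any commutative ring. -/

section PolynomialReduction

open Polynomial

variable {R : Type*} [CommRing R]

/-- The operator `G ↦ G' F - c G F'`. For `c = (t - r) / r` it describes the exterior derivative
`d (G y ^ (-(t - r))) = (G' F - c G F') y ^ (-t) dx` on `y ^ r = F`. -/
noncomputable def covDeriv (F : R[X]) (c : R) : R[X] →ₗ[R] R[X] :=
  (LinearMap.mulRight R F).comp derivative - c • LinearMap.mulRight R (derivative F)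

theorem covDeriv_apply (F : R[X]) (c : R) (G : R[X]) :
    covDeriv F c G = derivative G * F - C c * G * derivative F := by
  simp [covDeriv, smul_eq_C_mul, mul_assoc]

theorem natDegree_covDeriv_le {F : R[X]} {d : ℕ} (hF : F.natDegree = d) (hd : 0 < d) (c : R)
    {G : R[X]} {m : ℕ} (hG : G.natDegree ≤ m) : (covDeriv F c G).natDegree ≤ m + d - 1 := by
  rw [covDeriv_apply]
  refine (natDegree_sub_le _ _).trans (max_le ?_ ?_)
  · rcases Nat.eq_zero_or_pos m with rfl | hm
    · rw [Nat.le_zero] at hG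
      rw [eq_C_of_natDegree_eq_zero hG]
      simp
    · have h1 := natDegree_derivative_le G
      have h2 := natDegree_mul_le (p := derivative G) (q := F)
      omega
  · have h1 := natDegree_derivative_le F
    have h2 := natDegree_mul_le (p := C c * G) (q := derivative F)
    have h3 := natDegree_C_mul_le c G
    omega

/-- The factor `m - c d` is the divisor in every reduction step at infinity; its `p`-adic valuation
is the loss of precision there. -/
theorem coeff_covDeriv {F : R[X]} {d : ℕ} (hF : F.natDegree = d) (hd : 0 < d) (c : R)
    {G : R[X]} {m : ℕ} (hG : G.natDegree ≤ m) :
    (covDeriv F c G).coeff (m + d - 1) = (m - c * d) * (G.coeff m * F.coeff d) := by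
  have h2 : (C c * G * derivative F).coeff (m + d - 1) = c * d * (G.coeff m * F.coeff d) := by
    rw [show m + d - 1 = m + (d - 1) by omega, coeff_mul_add_eq_of_natDegree_le
      ((natDegree_C_mul_le c G).trans hG) ((natDegree_derivative_le F).trans (by omega)),
      coeff_C_mul, coeff_derivative, Nat.sub_add_cancel hd, Nat.cast_sub hd]
    push_cast
    ring
  rw [covDeriv_apply, coeff_sub, h2]
  rcases m with _ | m
  · rw [Nat.le_zero] at hG
    rw [eq_C_of_natDegree_eq_zero hG]
    simp
  · rw [show m + 1 + d - 1 = m + d by omega, coeff_mul_add_eq_of_natDegree_le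
      ((natDegree_derivative_le G).trans (by omega)) hF.le, coeff_derivative]
    push_cast
    ring

/-- Because of this, a primitive that is correct modulo `F ^ h` may be altered by any multiple of `F
^ h`, which is the freedom used for gluing. -/
theorem dvd_covDeriv_pow_mul (F : R[X]) (c : R) (h : ℕ) (G : R[X]) :
    F ^ h ∣ covDeriv F c (F ^ h * G) := by
  rw [covDeriv_apply, derivative_mul, derivative_pow]
  rcases h with _ | h
  · simp
  · refine ⟨C ((h + 1 : ℕ) : R) * derivative F * G + derivative G * F - C c * G * derivative F, ?_⟩
    rw [Nat.add_sub_cancel]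
    ring

/-- Newton iteration: `F` has a root congruent to `X` modulo arbitrary powers of `F`. -/
theorem exists_dvd_comp {F : R[X]} (hF : F.Separable) (h : ℕ) :
    ∃ Y : R[X], F ∣ Y - X ∧ F ^ (h + 1) ∣ F.comp Y := by
  obtain ⟨U, V, hUV⟩ := hF
  induction h with
  | zero => exact ⟨X, by simp, by simp⟩
  | succ h ih =>
    obtain ⟨Y, hY, hFY⟩ := ih
    -- From `U F + V F' = 1`, the polynomial `V(Y)` inverts `F'(Y)` modulo `F(Y)`, so this is the
    -- Newton step without a division.
    refine ⟨Y - V.comp Y * F.comp Y, ?_, ?_⟩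
    · rw [sub_right_comm]
      exact dvd_sub hY (((dvd_pow_self F h.succ_ne_zero).trans hFY).mul_left _)
    · obtain ⟨K, hK⟩ := (F.map C).binomExpansion Y (-(V.comp Y * F.comp Y))
      have h1 := congrArg (fun P => P.comp Y) hUV
      simp only [add_comp, mul_comp, one_comp] at h1
      rw [derivative_map] at hK
      simp only [eval_map] at hK
      change F.comp _ = F.comp Y + (derivative F).comp Y * _ + _ at hK
      have h2 : F.comp (Y - V.comp Y * F.comp Y) =
          F.comp Y ^ 2 * (U.comp Y + K * V.comp Y ^ 2) := by
        rw [sub_eq_add_neg, hK]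
        linear_combination (-F.comp Y) * h1
      rw [h2]
      refine Dvd.dvd.mul_right ((pow_dvd_pow F ?_).trans ((pow_mul F (h + 1) 2).symm ▸
        pow_dvd_pow_of_dvd hFY 2)) _
      omega

/-- Differentiating `F(Y) = F^(h+1) Q` shows that `F ^ h` divides `Y' F'(Y)`, and `F'(Y)` is
invertible modulo `F(Y)`. Consequently every polynomial in `Y` has derivative divisible by `F ^ h`:
these are the constants for the `F`-adic expansion. -/
theorem dvd_derivative_of_dvd_comp {F : R[X]} (hF : F.Separable) {h : ℕ} {Y : R[X]}
    (hY : F ^ (h + 1) ∣ F.comp Y) : F ^ h ∣ derivative Y := by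
  obtain ⟨U, V, hUV⟩ := hF
  have h1 := congrArg (fun P => P.comp Y) hUV
  simp only [add_comp, mul_comp, one_comp] at h1
  have h2 : F ^ h ∣ derivative Y * (derivative F).comp Y := by
    rw [← derivative_comp]
    obtain ⟨Q, hQ⟩ := hY
    rw [hQ, derivative_mul, derivative_pow]
    refine dvd_add ((Dvd.intro_left (C ((h + 1 : ℕ) : R) * derivative F) ?_).mul_right _)
      (Dvd.intro (F * derivative Q) ?_)
    · rw [Nat.add_sub_cancel]; ring
    · ring
  have h3 : derivative Y = (derivative Y * (derivative F).comp Y) * V.comp Y +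
      derivative Y * U.comp Y * F.comp Y := by
    linear_combination (-derivative Y) * h1
  rw [h3]
  exact dvd_add (h2.mul_right _) (((pow_dvd_pow F h.le_succ).trans hY).mul_left _)

/-- Every polynomial has an `F`-adic expansion whose digits are constant modulo `F ^ h`. -/
theorem exists_horizontal_expansion {F : R[X]} (hF : F.Separable) (S : R[X]) (h m : ℕ) :
    ∃ e : ℕ → R[X], (∀ n, F ^ h ∣ derivative (e n)) ∧
      F ^ m ∣ S - ∑ n ∈ Finset.range m, derivative F * e n * F ^ n := by
  obtain ⟨Y, hYX, hY⟩ := exists_dvd_comp hF h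
  have hY' := dvd_derivative_of_dvd_comp hF hY
  obtain ⟨U, V, hUV⟩ := hF
  induction m with
  | zero => exact ⟨0, by simp, by simp⟩
  | succ m ih =>
    obtain ⟨e, he, Q, hQ⟩ := ih
    -- `F' V Q ≡ Q` modulo `F`, so `V Q` is a valid next digit; replacing `X` by `Y ≡ X` keeps it
    -- valid and makes it horizontal.
    refine ⟨Function.update e m ((V * Q).comp Y), fun n => ?_, ?_⟩
    · rcases eq_or_ne n m with rfl | hn
      · rw [Function.update_self, derivative_comp]
        exact hY'.mul_right _
      · rw [Function.update_of_ne hn]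
        exact he n
    · rw [Finset.sum_range_succ, Function.update_self, Finset.sum_congr rfl (g := fun n =>
        derivative F * e n * F ^ n) fun n hn => by
          rw [Function.update_of_ne (Finset.mem_range.1 hn).ne], ← sub_sub, hQ]
      have h1 : F ∣ (V * Q).comp Y - V * Q := by
        have := (sub_dvd_eval_sub Y X ((V * Q).map C))
        simp only [eval_map] at this
        change _ ∣ (V * Q).comp Y - (V * Q).comp X at this
        rw [comp_X] at this
        exact hYX.trans this
      obtain ⟨K, hK⟩ := h1
      refine ⟨Q * U - derivative F * K, ?_⟩
      linear_combination (-derivative F * F ^ m) * hK - F ^ m * Q * hUV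

/-- Reduction of pole orders along `F = 0`: modulo `F ^ h`, the operator `covDeriv F c` reaches
every multiple of a common multiple `q` of the numbers `n - c`. -/
theorem exists_dvd_sub_covDeriv {F : R[X]} (hF : F.Separable) (c q : R) (h : ℕ)
    (hq : ∀ n < h, ∃ w : R, w * (n - c) = q) (S : R[X]) :
    ∃ G : R[X], F ^ h ∣ C q * S - covDeriv F c G := by
  obtain ⟨e, he, hS⟩ := exists_horizontal_expansion hF S h h
  have hw : ∀ n, ∃ w : R, n < h → w * (n - c) = q := fun n => by
    by_cases hn : n < h
    · exact (hq n hn).imp fun w hw _ => hw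
    · exact ⟨0, fun h' => absurd h' hn⟩
  choose w hw using hw
  -- `covDeriv F c (e F^n) = (n - c) F' e F^n + e' F^(n+1)`, and the last term vanishes modulo `F ^
  -- h`. The digits therefore decouple, and each is divided by its own `n - c` only.
  refine ⟨∑ n ∈ Finset.range h, C (w n) * (e n * F ^ n), ?_⟩
  have h1 : C q * S - covDeriv F c (∑ n ∈ Finset.range h, C (w n) * (e n * F ^ n)) =
      C q * (S - ∑ n ∈ Finset.range h, derivative F * e n * F ^ n) -
        ∑ n ∈ Finset.range h, derivative (e n) * (C (w n) * F ^ (n + 1)) := by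
    rw [mul_sub, sub_sub, map_sum, Finset.mul_sum, ← Finset.sum_add_distrib]
    congr 1
    refine Finset.sum_congr rfl fun n hn => ?_
    rw [← hw n (Finset.mem_range.1 hn), covDeriv_apply, derivative_C_mul, derivative_mul,
      derivative_pow]
    simp only [C_mul, C_sub]
    rcases n with _ | n
    · simp
      ring
    · rw [Nat.add_sub_cancel]
      ring
  rw [h1]
  exact dvd_sub (hS.mul_left _) (Finset.dvd_sum fun n _ => (he n).mul_right _)

/-- Reduction of degrees from the top. -/
theorem exists_natDegree_sub_covDeriv_lt (F : R[X]) (c q : R) {lo hi : ℕ} (hlo : 0 < lo)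
    (H : ∀ D, lo ≤ D → D ≤ hi → ∃ G Q : R[X], covDeriv F c G = C q * Q ∧ G.natDegree ≤ D ∧
      Q.natDegree ≤ D ∧ Q.coeff D = 1) (S : R[X]) (hS : S.natDegree ≤ hi) :
    ∃ G : R[X], G.natDegree ≤ hi ∧ (C q * S - covDeriv F c G).natDegree < lo := by
  suffices h : ∀ n ≤ hi, ∀ S : R[X], S.natDegree ≤ n →
      ∃ G : R[X], G.natDegree ≤ hi ∧ (C q * S - covDeriv F c G).natDegree < lo from
    h hi le_rfl S hS
  intro n
  induction n with
  | zero =>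
    intro _ S hS
    refine ⟨0, by simp, ?_⟩
    rw [map_zero, sub_zero]
    have := natDegree_C_mul_le q S
    omega
  | succ n ih =>
    intro hn S hS
    by_cases hnlo : n + 1 < lo
    · refine ⟨0, by simp, ?_⟩
      rw [map_zero, sub_zero]
      have := natDegree_C_mul_le q S
      omega
    · obtain ⟨G, Q, hGQ, hG, hQ, hQ1⟩ := H (n + 1) (by omega) hn
      -- The leading term is removed from `S` itself and not from `q S`, so the factor `q` is paid
      -- once and not once per degree.
      have h1 : (S - C (S.coeff (n + 1)) * Q).natDegree ≤ n := by
        rw [natDegree_le_iff_coeff_eq_zero]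
        intro N hN
        rcases (Nat.succ_le_of_lt hN).eq_or_lt with rfl | hN'
        · simp [hQ1]
        · rw [coeff_sub, coeff_C_mul, coeff_eq_zero_of_natDegree_lt (hS.trans_lt hN'),
            coeff_eq_zero_of_natDegree_lt (hQ.trans_lt hN'), mul_zero, sub_zero]
      obtain ⟨G', hG', h2⟩ := ih (by omega) _ h1
      refine ⟨C (S.coeff (n + 1)) * G + G', (natDegree_add_le _ _).trans (max_le
        ((natDegree_C_mul_le _ _).trans (hG.trans hn)) hG'), ?_⟩
      convert h2 using 2
      rw [map_add, ← smul_eq_C_mul _ (p := G), map_smul, hGQ, smul_eq_C_mul]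
      ring

/-- A reduction along `F = 0` and a reduction at infinity combine to a full reduction. -/
theorem exists_eq_covDeriv_add {F : R[X]} {d h : ℕ} (hF : F.natDegree = d) (hd : 2 ≤ d)
    (hlc : IsUnit F.leadingCoeff) (hh : 0 < h) (c q q' : R) (S G₁ G₂ : R[X])
    (h₁ : F ^ h ∣ C (q' * q) * S - covDeriv F c G₁)
    (h₂ : (C q * S - covDeriv F c G₂).natDegree < d * h + d - 1) :
    ∃ G η : R[X], C (q' * q) * S = covDeriv F c G + F ^ h * η ∧ η.natDegree < d - 1 ∧
      G.natDegree ≤ max (d * h) G₂.natDegree := by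
  rcases subsingleton_or_nontrivial R with hR | hR
  · exact ⟨0, 0, Subsingleton.elim _ _, by simp; omega, by simp⟩
  set a := hlc.unit
  have ha : (a : R) = F.leadingCoeff := rfl
  set M : R[X] := C (↑a⁻¹ ^ h : R) * F ^ h with hM
  have hlcp : (F ^ h).leadingCoeff = F.leadingCoeff ^ h :=
    leadingCoeff_pow' (hlc.pow h).ne_zero
  have hdegp : (F ^ h).natDegree = d * h := by
    rw [natDegree_pow' (hlc.pow h).ne_zero, hF, mul_comm]
  have hmonic : M.Monic := by
    rw [Monic, hM, leadingCoeff_mul', leadingCoeff_C, hlcp, ← mul_pow, ← ha, Units.inv_mul,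
      one_pow]
    rw [leadingCoeff_C, hlcp, ← mul_pow, ← ha, Units.inv_mul, one_pow]
    exact one_ne_zero
  have hMdeg : M.natDegree ≤ d * h := (natDegree_C_mul_le _ _).trans hdegp.le
  set G₂' := C q' * G₂
  have hMne : M ≠ 1 := by
    intro h0
    have : (C ((a : R) ^ h) * M).natDegree ≤ 0 := by rw [h0, mul_one, natDegree_C]
    rw [hM, ← mul_assoc, ← C_mul, ← mul_pow, Units.mul_inv, one_pow, C_1, one_mul, hdegp] at this
    have : 0 < d * h := Nat.mul_pos (by omega) hh
    omega
  -- The remainder of `G₁` is joined to the quotient of `q' G₂`: `G` agrees with `G₁` modulo `F ^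
  -- h`, and with `q' G₂` up to degree below `d h`.
  set G := G₁ %ₘ M + M * (G₂' /ₘ M) with hG
  have e1 : G = G₁ + M * (G₂' /ₘ M - G₁ /ₘ M) := by
    have := modByMonic_add_div G₁ M
    rw [hG]
    linear_combination this
  have e2 : G = G₂' + (G₁ %ₘ M - G₂' %ₘ M) := by
    have := modByMonic_add_div G₂' M
    rw [hG]
    linear_combination this
  have hlt1 : (G₁ %ₘ M).natDegree < d * h := (natDegree_modByMonic_lt _ hmonic hMne).trans_le hMdeg
  have hlt2 : (G₂' %ₘ M).natDegree < d * h :=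
    (natDegree_modByMonic_lt _ hmonic hMne).trans_le hMdeg
  have hlt : (G₁ %ₘ M - G₂' %ₘ M).natDegree ≤ d * h - 1 := by
    have := natDegree_sub_le (G₁ %ₘ M) (G₂' %ₘ M)
    rw [le_max_iff] at this
    omega
  have hdvd : F ^ h ∣ C (q' * q) * S - covDeriv F c G := by
    rw [e1, map_add, ← sub_sub]
    refine dvd_sub h₁ ?_
    rw [hM, mul_assoc, mul_left_comm]
    exact dvd_covDeriv_pow_mul F c h _
  obtain ⟨η, hη⟩ := hdvd
  -- The change of degree below `d h` contributes less than `d h + d - 1` after `covDeriv`, so the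
  -- reduction at infinity survives the gluing.
  have hdeg : (F ^ h * η).natDegree < d * h + d - 1 := by
    rw [← hη, e2]
    have h3 : C (q' * q) * S - covDeriv F c (G₂' + (G₁ %ₘ M - G₂' %ₘ M)) =
        C q' * (C q * S - covDeriv F c G₂) - covDeriv F c (G₁ %ₘ M - G₂' %ₘ M) := by
      rw [map_add, show G₂' = q' • G₂ from (smul_eq_C_mul q').symm, map_smul, smul_eq_C_mul, C_mul]
      ring
    rw [h3]
    have h4 := natDegree_covDeriv_le hF (by omega) c hlt
    have h5 := natDegree_C_mul_le q' (C q * S - covDeriv F c G₂)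
    have h6 := natDegree_sub_le (C q' * (C q * S - covDeriv F c G₂))
      (covDeriv F c (G₁ %ₘ M - G₂' %ₘ M))
    rw [le_max_iff] at h6
    have : 0 < d * h := Nat.mul_pos (by omega) hh
    omega
  refine ⟨G, η, by rw [← hη]; ring, ?_, ?_⟩
  · rcases eq_or_ne η 0 with rfl | h0
    · simp; omega
    · rw [natDegree_mul', hdegp] at hdeg
      · omega
      · rw [hlcp]
        exact fun h7 => h0 (leadingCoeff_eq_zero.1 ((hlc.pow h).mul_right_eq_zero.1 h7))
  · rw [e2]
    refine (natDegree_add_le _ _).trans (max_le ?_ ?_)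
    · exact (natDegree_C_mul_le _ _).trans (le_max_right _ _)
    · exact le_max_of_le_left (hlt.trans (Nat.sub_le _ _))

end PolynomialReduction

/-! ### Denominators of the reduction over the Witt vectors. -/

section WittReduction

open Polynomial

variable {p : ℕ} [Fact p.Prime] {k : Type*} [Field k] [CharP k p]

theorem isUnit_witt_of_constantCoeff_ne_zero {w : WittVector p k}
    (hw : WittVector.constantCoeff w ≠ 0) : IsUnit w :=
  WittVector.isUnit_of_coeff_zero_ne_zero w hw

theorem isUnit_intCast_witt {z : ℤ} (hz : ¬ (p : ℤ) ∣ z) : IsUnit (z : WittVector p k) :=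
  isUnit_witt_of_constantCoeff_ne_zero (by
    rwa [map_intCast, Ne, CharP.intCast_eq_zero_iff k p])

theorem isUnit_natCast_witt {n : ℕ} (hn : ¬ p ∣ n) : IsUnit (n : WittVector p k) := by
  have := isUnit_intCast_witt (k := k) (z := n) (by exact_mod_cast hn)
  exact_mod_cast this

/-- The `p`-adic valuation of `n` is at most `L`, and the prime-to-`p` part of `n` is a unit. -/
theorem exists_mul_natCast_eq_pow {n L : ℕ} (hn : 0 < n) (h : n < p ^ (L + 1)) :
    ∃ w : WittVector p k, w * n = p ^ L := by
  have hp : p.Prime := Fact.out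
  obtain ⟨v, m, hm, rfl⟩ := Nat.exists_eq_pow_mul_and_not_dvd hn.ne' p hp.ne_one
  have hmpos : 0 < m := Nat.pos_of_ne_zero fun h0 => hm (h0 ▸ dvd_zero p)
  have hv : v < L + 1 := (Nat.pow_lt_pow_iff_right hp.one_lt).1
    ((Nat.le_mul_of_pos_right _ hmpos).trans_lt h)
  obtain ⟨u, hu⟩ := isUnit_natCast_witt (k := k) hm
  refine ⟨p ^ (L - v) * ↑u⁻¹, ?_⟩
  push_cast
  rw [← hu, mul_comm (_ ^ v), ← mul_assoc, mul_assoc _ (↑u⁻¹ : WittVector p k), Units.inv_mul,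
    mul_one, ← pow_add]
  congr 1
  omega

theorem isUnit_leadingCoeff_of_natDegree_map {F : (WittVector p k)[X]}
    (hF : (F.map WittVector.constantCoeff).natDegree = F.natDegree) (hd : F.natDegree ≠ 0) :
    IsUnit F.leadingCoeff := by
  refine isUnit_witt_of_constantCoeff_ne_zero ?_
  rw [leadingCoeff, ← hF, ← coeff_map, coeff_natDegree, Ne, leadingCoeff_eq_zero]
  intro h
  rw [h, natDegree_zero] at hF
  exact hd hF.symm

/-- The resultant of `F` and `F'` is a unit because its residue is nonzero. The bound `d < p` keeps
the derivative of the residue polynomial in degree exactly `d - 1`, so that forming the resultant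
commutes with reduction. -/
theorem separable_of_separable_map {F : (WittVector p k)[X]}
    (hF : (F.map WittVector.constantCoeff).natDegree = F.natDegree) (hd : F.natDegree ≠ 0)
    (hdp : F.natDegree < p) (hsep : (F.map WittVector.constantCoeff).Separable) :
    F.Separable := by
  have hdF : F.natDegree - 1 + 1 = F.natDegree := by omega
  have hne : (F.map WittVector.constantCoeff).coeff F.natDegree ≠ 0 := by
    rw [← hF, coeff_natDegree, Ne, leadingCoeff_eq_zero]
    intro h
    rw [h, natDegree_zero] at hF
    exact hd hF.symm
  have hdeg : (derivative (F.map WittVector.constantCoeff)).natDegree = F.natDegree - 1 := by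
    refine natDegree_eq_of_le_of_coeff_ne_zero ((natDegree_derivative_le _).trans (by rw [hF])) ?_
    rw [coeff_derivative, hdF]
    refine mul_ne_zero hne ?_
    rw [← Nat.cast_add_one, hdF, Ne, CharP.cast_eq_zero_iff k p]
    exact fun h => absurd (Nat.le_of_dvd (by omega) h) (by omega)
  have h1 := resultant_ne_zero _ _ hsep
  rw [hdeg, hF, derivative_map, resultant_map_map] at h1
  obtain ⟨u, hu⟩ := isUnit_witt_of_constantCoeff_ne_zero h1
  obtain ⟨U, V, -, -, hUV⟩ := exists_mul_add_mul_eq_C_resultant F (derivative F) le_rfl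
    (natDegree_derivative_le F) (Or.inl hd)
  rw [← hu] at hUV
  refine ⟨C (↑u⁻¹ : WittVector p k) * U, C (↑u⁻¹ : WittVector p k) * V, ?_⟩
  have h2 : C (↑u⁻¹ : WittVector p k) * C (u : WittVector p k) = 1 := by
    rw [← C_mul, Units.inv_mul, C_1]
  linear_combination C (↑u⁻¹ : WittVector p k) * hUV + h2

theorem natCast_p_ne_zero_witt : (p : WittVector p k) ≠ 0 :=
  WittVector.p_nonzero p k

/-- A primitive of a multiple of `x ^ (m + d - 1) y ^ (-p τ) dx` up to lower degree: every
degree above the critical range costs at most one factor `p`. -/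
theorem exists_covDeriv_leading {F : (WittVector p k)[X]} {d : ℕ} (hF : F.natDegree = d)
    (hd : 0 < d) (hlc : IsUnit F.leadingCoeff) {r τ m : ℕ} {ρ : WittVector p k}
    (hρ : r * ρ = 1) (hpr : ¬ p ∣ r) (hm : d * (p - 1) ≤ m)
    (he0 : (m * r + d * r - d * (p * τ) : ℤ) ≠ 0)
    (he : |(m * r + d * r - d * (p * τ) : ℤ)| < p ^ 2) :
    ∃ G Q : (WittVector p k)[X], covDeriv F (p * τ * ρ - 1) G = C (p : WittVector p k) * Q ∧
      G.natDegree ≤ m + d - 1 ∧ Q.natDegree ≤ m + d - 1 ∧ Q.coeff (m + d - 1) = 1 := by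
  have hp : p.Prime := Fact.out
  have hlc' : IsUnit (F.coeff d) := by rwa [← hF]
  have hρu : IsUnit ρ := IsUnit.of_mul_eq_one_right _ hρ
  suffices h : ∃ G Q : (WittVector p k)[X],
      covDeriv F (p * τ * ρ - 1) G = C (p : WittVector p k) * Q ∧
      G.natDegree ≤ m ∧ IsUnit (Q.coeff (m + d - 1)) by
    obtain ⟨G, Q, hGQ, hG, u, hu⟩ := h
    refine ⟨C (↑u⁻¹ : WittVector p k) * G, C (↑u⁻¹ : WittVector p k) * Q, ?_, (natDegree_C_mul_le _ _).trans (by omega),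
      (natDegree_C_mul_le _ _).trans ?_, ?_⟩
    · rw [← smul_eq_C_mul, map_smul, hGQ, smul_eq_C_mul, mul_left_comm]
    · have := natDegree_covDeriv_le hF hd (p * τ * ρ - 1) hG
      rwa [hGQ, natDegree_C_mul natCast_p_ne_zero_witt] at this
    · rw [coeff_C_mul, ← hu, Units.inv_mul]
  -- This integer is `r` times the divisor `m - c d` from `coeff_covDeriv`, for `c = pτ/r - 1`.
  by_cases hdvd : (p : ℤ) ∣ (m * r + d * r - d * (p * τ) : ℤ)
  · have h1 : p ∣ (m + d) * r := by
      have h2 : (p : ℤ) ∣ (m + d) * r := by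
        rw [show ((m : ℤ) + d) * r = (m * r + d * r - d * (p * τ)) + p * (d * τ) by ring]
        exact dvd_add hdvd (dvd_mul_right _ _)
      exact_mod_cast h2
    obtain ⟨n', hn'⟩ := (hp.dvd_mul.1 h1).resolve_right hpr
    have hdn : d ≤ n' := by
      have h3 : d * (p - 1) + d = p * d := by
        rw [mul_comm p d]
        nth_rewrite 2 [← mul_one d]
        rw [← mul_add, Nat.sub_add_cancel hp.one_lt.le]
      exact Nat.le_of_mul_le_mul_left (by omega) hp.pos
    obtain ⟨n, rfl⟩ := Nat.exists_eq_add_of_le' hdn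
    have hmn : m = p * n + (p - 1) * d := by
      have h4 : (p - 1) * d + d = p * d := by
        nth_rewrite 2 [← one_mul d]
        rw [← add_mul, Nat.sub_add_cancel hp.one_lt.le]
      rw [mul_add] at hn'
      omega
    have hm1 : (X ^ (p * n) : (WittVector p k)[X]).natDegree ≤ p * n := natDegree_X_pow_le _
    have hm2 : (F ^ (p - 1)).natDegree ≤ (p - 1) * d := natDegree_pow_le_of_le _ hF.le
    have hdeg : (X ^ (p * n) * F ^ (p - 1)).natDegree ≤ m := by
      have := natDegree_mul_le (p := (X ^ (p * n) : (WittVector p k)[X])) (q := F ^ (p - 1))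
      omega
    set Q : (WittVector p k)[X] := C (n : WittVector p k) * X ^ (p * n - 1) * F ^ p +
      C (1 - τ * ρ) * X ^ (p * n) * F ^ (p - 1) * derivative F with hQ
    -- On the curve `F^(p-1) y^(-(pτ-r)) = F^p y^(-pτ)`, so the primitive is the `p`-th power of
    -- `x^n F y^(-τ)` and its differential is divisible by `p`.
    have hGQ : covDeriv F (p * τ * ρ - 1) (X ^ (p * n) * F ^ (p - 1)) =
        C (p : WittVector p k) * Q := by
      obtain ⟨q, rfl⟩ : ∃ q, p = q + 2 := ⟨p - 2, by have := hp.two_le; omega⟩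
      rw [covDeriv_apply, derivative_mul, derivative_X_pow, derivative_pow, hQ,
        show q + 2 - 1 = q + 1 by omega, Nat.add_sub_cancel]
      simp only [C_sub, C_mul, C_1, C_eq_natCast]
      push_cast
      ring
    refine ⟨_, Q, hGQ, hdeg, ?_⟩
    have h5 := coeff_covDeriv hF hd (p * τ * ρ - 1) hdeg
    have h6 : (X ^ (p * n) * F ^ (p - 1)).coeff m = F.coeff d ^ (p - 1) := by
      rw [hmn, coeff_mul_add_eq_of_natDegree_le hm1 hm2, coeff_X_pow_self, one_mul,
        coeff_pow_of_natDegree_le hF.le]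
    have hcast : (m : WittVector p k) + d = p * (n + d) := by
      have := congrArg (Nat.cast : ℕ → WittVector p k) hn'
      push_cast at this
      exact this
    have h7 : (m : WittVector p k) - (p * τ * ρ - 1) * d =
        p * (ρ * ((n + d) * r - d * τ : ℤ)) := by
      push_cast
      linear_combination hcast - (p * (n + d)) * hρ
    rw [hGQ, coeff_C_mul, h6, h7, mul_assoc] at h5
    rw [mul_left_cancel₀ natCast_p_ne_zero_witt h5]
    refine IsUnit.mul (hρu.mul (isUnit_intCast_witt ?_)) ((hlc'.pow _).mul hlc')
    have h8 : (m * r + d * r - d * (p * τ) : ℤ) = p * ((n + d) * r - d * τ) := by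
      have hcastZ : (m : ℤ) + d = p * (n + d) := by exact_mod_cast hn'
      linear_combination (r : ℤ) * hcastZ
    rw [h8] at he0 he
    have hp0 : (0 : ℤ) < p := by exact_mod_cast hp.pos
    rw [abs_mul, abs_of_pos hp0, sq] at he
    -- After removal of one `p`, a nonzero integer smaller than `p` is left, hence a unit.
    have h9 := lt_of_mul_lt_mul_left he hp0.le
    exact fun h => right_ne_zero_of_mul he0 (Int.eq_zero_of_abs_lt_dvd h h9)
  -- Here `X ^ m` already has a unit as leading coefficient; the factor `p` only makes the two cases
  -- uniform.
  · refine ⟨C (p : WittVector p k) * X ^ m, covDeriv F (p * τ * ρ - 1) (X ^ m), ?_,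
      (natDegree_C_mul_le _ _).trans (natDegree_X_pow_le _), ?_⟩
    · rw [← smul_eq_C_mul, map_smul, smul_eq_C_mul]
    · rw [coeff_covDeriv hF hd _ (natDegree_X_pow_le m), coeff_X_pow_self, one_mul]
      refine IsUnit.mul ?_ hlc'
      have h1 : (m : WittVector p k) - (p * τ * ρ - 1) * d =
          ρ * (m * r + d * r - d * (p * τ) : ℤ) := by
        push_cast
        linear_combination (-(m + d) : WittVector p k) * hρ
      rw [h1]
      exact hρu.mul (isUnit_intCast_witt hdvd)

/-- Reduction of `x ^ n y ^ (-p τ) dx` to degree at most `d - 2` and pole order `t₀`, with control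
of the denominator `p ^ L`. -/
theorem exists_reduction {F : (WittVector p k)[X]} {d : ℕ} (hF : F.natDegree = d)
    (hd : 2 ≤ d) (hlc : IsUnit F.leadingCoeff) (hsep : F.Separable) {r τ h t₀ L hi : ℕ}
    {ρ : WittVector p k} (hρ : r * ρ = 1) (hpr : ¬ p ∣ r) (hτ : p * τ = t₀ + h * r) (ht₀ : 0 < t₀)
    (hh : p ≤ h) (hL : 0 < L) (hτL : τ < p ^ L)
    (he : ∀ m : ℕ, d * h ≤ m → m + d - 1 ≤ hi → (m * r + d * r - d * (p * τ) : ℤ) ≠ 0 ∧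
      |(m * r + d * r - d * (p * τ) : ℤ)| < p ^ 2)
    (S : (WittVector p k)[X]) (hS : S.natDegree ≤ hi) :
    ∃ G η : (WittVector p k)[X], C ((p : WittVector p k) ^ L) * S =
      covDeriv F (p * τ * ρ - 1) G + F ^ h * η ∧ η.natDegree < d - 1 ∧
      G.natDegree ≤ max (d * h) hi := by
  have hp : p.Prime := Fact.out
  obtain ⟨L, rfl⟩ : ∃ L', L = L' + 1 := ⟨L - 1, by omega⟩
  have hvert : ∀ n < h, ∃ w : WittVector p k, w * (n - (p * τ * ρ - 1)) = p ^ (L + 1) := by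
    intro n hn
    obtain ⟨g, rfl⟩ : ∃ g, h = n + 1 + g := Nat.exists_eq_add_of_le hn
    have hpos : 0 < t₀ + g * r := by omega
    have hlt : t₀ + g * r < p ^ (L + 1 + 1) := by
      calc t₀ + g * r ≤ t₀ + (n + 1 + g) * r := by
            gcongr
            omega
        _ = p * τ := hτ.symm
        _ < p * p ^ (L + 1) := Nat.mul_lt_mul_of_pos_left hτL hp.pos
        _ = p ^ (L + 1 + 1) := (pow_succ' _ _).symm
    obtain ⟨w, hw⟩ := exists_mul_natCast_eq_pow (k := k) hpos hlt
    -- `r (n - c) = (n + 1) r - pτ = -(t₀ + g r)`, a negative integer of absolute value below `p ^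
    -- (L + 2)`.
    refine ⟨-(w * r), ?_⟩
    have hτ' : (p : WittVector p k) * τ = t₀ + (n + 1 + g) * r := by
      have := congrArg (Nat.cast : ℕ → WittVector p k) hτ
      push_cast at this
      exact this
    rw [← hw, hτ']
    push_cast
    linear_combination (w * (t₀ + (n + 1 + g) * r)) * hρ
  obtain ⟨G₁, hG₁⟩ := exists_dvd_sub_covDeriv hsep _ _ h hvert S
  have hh0 : 0 < h := hp.pos.trans_le hh
  have hdh : 0 < d * h := Nat.mul_pos (by omega) hh0
  obtain ⟨G₂, hG₂, hG₂'⟩ := exists_natDegree_sub_covDeriv_lt F (p * τ * ρ - 1)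
    (p : WittVector p k) (lo := d * h + d - 1) (hi := hi) (by omega) (fun D hD hD' => by
      obtain ⟨m, rfl⟩ : ∃ m, D = m + d - 1 := ⟨D - (d - 1), by omega⟩
      have hm : d * h ≤ m := by omega
      refine exists_covDeriv_leading hF (by omega) hlc hρ hpr ?_ (he m hm hD').1 (he m hm hD').2
      exact (Nat.mul_le_mul_left d (by omega)).trans hm) S hS
  -- The split `p^L * p` lets the reduction at infinity use the last factor `p`, so it adds nothing
  -- to the cost of the reduction along `F = 0`.
  rw [pow_succ] at hG₁ ⊢
  obtain ⟨G, η, h1, h2, h3⟩ := exists_eq_covDeriv_add hF hd hlc hh0 _ _ _ S G₁ G₂ hG₁ hG₂'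
  exact ⟨G, η, h1, h2, h3.trans (max_le_max le_rfl hG₂)⟩

end WittReduction

/-! ### Formal calculus of `p`-adic sums. -/

section PadicSum

variable (p : ℕ) {M M' : Type*} [CommRing M] [CommRing M']

/-- `C` is the `p`-adic sum of `c`: the first `2 n` terms determine it modulo `p ^ n`. -/
def HasPadicSum (c : ℕ → M) (C : M) : Prop :=
  ∀ n, (p : M) ^ n ∣ C - ∑ s ∈ Finset.range (2 * n), c s

variable {p}

theorem HasPadicSum.map {c : ℕ → M} {C : M} (h : HasPadicSum p c C) (φ : M →+ M') :
    HasPadicSum p (fun s => φ (c s)) (φ C) := fun n => by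
  obtain ⟨x, hx⟩ := h n
  refine ⟨φ x, ?_⟩
  rw [← map_sum, ← map_sub, hx, ← Nat.cast_pow, ← nsmul_eq_mul, map_nsmul, nsmul_eq_mul,
    Nat.cast_pow]

theorem HasPadicSum.mul_left {c : ℕ → M} {C : M} (h : HasPadicSum p c C) (a : M) :
    HasPadicSum p (fun s => a * c s) (a * C) :=
  h.map (AddMonoidHom.mulLeft a)

theorem HasPadicSum.add {c c' : ℕ → M} {C C' : M} (h : HasPadicSum p c C)
    (h' : HasPadicSum p c' C') : HasPadicSum p (fun s => c s + c' s) (C + C') := fun n => by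
  rw [Finset.sum_add_distrib, add_sub_add_comm]
  exact dvd_add (h n) (h' n)

theorem HasPadicSum.sub {c c' : ℕ → M} {C C' : M} (h : HasPadicSum p c C)
    (h' : HasPadicSum p c' C') : HasPadicSum p (fun s => c s - c' s) (C - C') := fun n => by
  rw [Finset.sum_sub_distrib, sub_sub_sub_comm]
  exact dvd_sub (h n) (h' n)

theorem HasPadicSum.sum {ι : Type*} (t : Finset ι) {c : ι → ℕ → M} {C : ι → M}
    (h : ∀ i ∈ t, HasPadicSum p (c i) (C i)) :
    HasPadicSum p (fun s => ∑ i ∈ t, c i s) (∑ i ∈ t, C i) := fun n => by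
  rw [Finset.sum_comm, ← Finset.sum_sub_distrib]
  exact Finset.dvd_sum fun i hi => h i hi n

end PadicSum

/-! ### Existence and uniqueness of `p`-adic sums of power series. -/

section WittSeries

open Polynomial

variable {p : ℕ}

theorem exists_mvPowerSeries_coeff {R : Type*} [CommRing R] (c : (Fin 3 →₀ ℕ) → R) :
    ∃ g : MvPowerSeries (Fin 3) R, ∀ e, MvPowerSeries.coeff e g = c e :=
  ⟨c, fun _ => rfl⟩

theorem pow_dvd_mvPowerSeries_iff {R : Type*} [CommRing R] {n : ℕ} {f : MvPowerSeries (Fin 3) R} :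
    (p : MvPowerSeries (Fin 3) R) ^ n ∣ f ↔ ∀ e, (p : R) ^ n ∣ MvPowerSeries.coeff e f := by
  have hC : (p : MvPowerSeries (Fin 3) R) ^ n = MvPowerSeries.C ((p : R) ^ n) := by simp
  rw [hC]
  constructor
  · rintro ⟨g, rfl⟩ e
    rw [MvPowerSeries.coeff_C_mul]
    exact dvd_mul_right _ _
  · intro h
    choose g hg using h
    obtain ⟨G, hG⟩ := exists_mvPowerSeries_coeff g
    exact ⟨G, MvPowerSeries.ext fun e => by rw [hg e, MvPowerSeries.coeff_C_mul, hG]⟩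

/-- At an exponent of total degree `D`, a finite partial sum gives the coefficient modulo `p ^ D`,
and an error divisible by `p ^ D` satisfies every bound of positive slope. -/
theorem HasPadicSum.growthBound {a b : ℕ} {R : Type*} [CommRing R] (hb : 0 < b)
    {f : ℕ → MvPowerSeries (Fin 3) R} {S : MvPowerSeries (Fin 3) R}
    (h : HasPadicSum p f S) (hf : ∀ s, GrowthBound p a b (f s)) : GrowthBound p a b S := by
  intro e
  have h1 := pow_dvd_mvPowerSeries_iff.1 (h e.degree) e
  rw [← sub_add_cancel S (∑ s ∈ Finset.range (2 * e.degree), f s), map_add]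
  refine CoeffBound.add ⟨e.degree, ?_, h1⟩ ?_
  · exact (Nat.le_mul_of_pos_left _ hb).trans (Nat.le_add_left _ _)
  · rw [map_sum]
    exact CoeffBound.sum hb fun s _ => hf s e

variable [Fact p.Prime] {k : Type*} [Field k] [CharP k p] [Finite k]

theorem witt_eq_zero_of_pow_dvd {x : WittVector p k} (h : ∀ n, (p : WittVector p k) ^ n ∣ x) :
    x = 0 := by
  refine IsHausdorff.haus' (I := Ideal.span {(p : WittVector p k)}) x fun n => ?_
  rw [SModEq.zero, smul_eq_mul, Ideal.mul_top, Ideal.span_singleton_pow, Ideal.mem_span_singleton]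
  exact h n

theorem exists_hasPadicSum_witt (c : ℕ → WittVector p k) :
    ∃ C, HasPadicSum p (fun s => (p : WittVector p k) ^ (s / 2) * c s) C := by
  obtain ⟨C, hC⟩ := IsPrecomplete.prec' (I := Ideal.span {(p : WittVector p k)})
    (f := fun n => ∑ s ∈ Finset.range (2 * n), (p : WittVector p k) ^ (s / 2) * c s)
    fun {m n} hmn => by
      rw [SModEq.sub_mem, smul_eq_mul, Ideal.mul_top, Ideal.span_singleton_pow,
        Ideal.mem_span_singleton, ← neg_sub, ← Finset.sum_Ico_eq_sub _ (by omega), dvd_neg]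
      refine Finset.dvd_sum fun s hs => ((pow_dvd_pow _ ?_).mul_right _)
      rw [Finset.mem_Ico] at hs
      omega
  refine ⟨C, fun n => ?_⟩
  have := hC n
  rwa [SModEq.sub_mem, smul_eq_mul, Ideal.mul_top, Ideal.span_singleton_pow,
    Ideal.mem_span_singleton, ← neg_sub, dvd_neg] at this

theorem HasPadicSum.unique {c : ℕ → MvPowerSeries (Fin 3) (WittVector p k)}
    {C C' : MvPowerSeries (Fin 3) (WittVector p k)} (h : HasPadicSum p c C)
    (h' : HasPadicSum p c C') : C = C' := by
  rw [← sub_eq_zero]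
  ext e : 1
  refine witt_eq_zero_of_pow_dvd fun n => ?_
  refine pow_dvd_mvPowerSeries_iff.1 ?_ e
  rw [← sub_sub_sub_cancel_right]
  exact dvd_sub (h n) (h' n)

theorem exists_hasPadicSum_mvPowerSeries (f : ℕ → MvPowerSeries (Fin 3) (WittVector p k)) :
    ∃ S, HasPadicSum p
      (fun s => (p : MvPowerSeries (Fin 3) (WittVector p k)) ^ (s / 2) * f s) S := by
  choose c hc using fun e => exists_hasPadicSum_witt fun s => MvPowerSeries.coeff e (f s)
  obtain ⟨S, hS⟩ := exists_mvPowerSeries_coeff c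
  refine ⟨S, fun n => pow_dvd_mvPowerSeries_iff.2 fun e => ?_⟩
  convert hc e n using 1
  rw [map_sub, map_sum, hS]
  congr 1
  refine Finset.sum_congr rfl fun s _ => ?_
  rw [show (p : MvPowerSeries (Fin 3) (WittVector p k)) ^ (s / 2) =
    MvPowerSeries.C ((p : WittVector p k) ^ (s / 2)) by simp, MvPowerSeries.coeff_C_mul]

end WittSeries

/-! ### Growth bounds for explicit series. -/

section Growth

open Polynomial

variable {p : ℕ} {R : Type*} [CommRing R]

theorem GrowthBound.add {a b : ℕ} {f g : MvPowerSeries (Fin 3) R} (hf : GrowthBound p a b f)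
    (hg : GrowthBound p a b g) : GrowthBound p a b (f + g) := fun s => by
  rw [map_add]
  exact (hf s).add (hg s)

theorem GrowthBound.sum {ι : Type*} {a b : ℕ} (hb : 0 < b) {t : Finset ι}
    {f : ι → MvPowerSeries (Fin 3) R} (h : ∀ i ∈ t, GrowthBound p a b (f i)) :
    GrowthBound p a b (∑ i ∈ t, f i) := fun s => by
  rw [map_sum]
  exact CoeffBound.sum hb fun i hi => h i hi s

theorem GrowthBound.C_mul {a b : ℕ} {f : MvPowerSeries (Fin 3) R} (hf : GrowthBound p a b f)
    (c : R) : GrowthBound p a b (MvPowerSeries.C c * f) := fun s => by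
  rw [MvPowerSeries.coeff_C_mul]
  exact (hf s).mul_left c

theorem GrowthBound.X {b : ℕ} (hb : 0 < b) (i : Fin 3) :
    GrowthBound p 1 b (MvPowerSeries.X i : MvPowerSeries (Fin 3) R) := by
  classical
  intro s
  rw [MvPowerSeries.coeff_X]
  split_ifs with h
  · exact ⟨0, by simp [h], by simp⟩
  · exact CoeffBound.zero hb

theorem GrowthBound.X_pow {b : ℕ} (hb : 0 < b) (i : Fin 3) (n : ℕ) :
    GrowthBound p n b (MvPowerSeries.X i ^ n : MvPowerSeries (Fin 3) R) := by
  simpa using (GrowthBound.X hb i).pow hb n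

theorem GrowthBound.aeval_X {b : ℕ} (hb : 0 < b) (i : Fin 3) {n : ℕ} {P : R[X]}
    (hP : P.natDegree ≤ n) :
    GrowthBound p n b (aeval (MvPowerSeries.X i : MvPowerSeries (Fin 3) R) P) := by
  rw [aeval_eq_sum_range]
  refine GrowthBound.sum hb fun m hm => ?_
  rw [Algebra.smul_def, MvPowerSeries.algebraMap_apply, Algebra.algebraMap_self_apply]
  refine ((GrowthBound.X_pow hb i m).mono ?_ le_rfl).C_mul _
  rw [Finset.mem_range] at hm
  omega

/-- Powers of `p` buy degree at the rate `b`; this converts linearly growing degrees with growing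
`p`-powers into one uniform bound. -/
theorem GrowthBound.pow_mul {a b v a' : ℕ} {f : MvPowerSeries (Fin 3) R}
    (hf : GrowthBound p a b f) (ha : a ≤ a' + b * v) :
    GrowthBound p a' b ((p : MvPowerSeries (Fin 3) R) ^ v * f) := fun s => by
  obtain ⟨w, hw, hd⟩ := hf s
  refine ⟨v + w, ?_, ?_⟩
  · rw [mul_add]
    omega
  · rw [show (p : MvPowerSeries (Fin 3) R) ^ v = MvPowerSeries.C ((p : R) ^ v) by simp,
      MvPowerSeries.coeff_C_mul, pow_add]
    exact mul_dvd_mul_left _ hd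

end Growth

/-! ### Summing infinitely many reductions. -/

section ReductionSeries

open Polynomial

variable {p : ℕ} {k : Type*}

theorem pderiv_aeval_X {R : Type*} [CommRing R] (P : R[X]) :
    MvPowerSeries.pderiv R (0 : Fin 3) (aeval (MvPowerSeries.X 0 : MvPowerSeries (Fin 3) R) P) =
      aeval (MvPowerSeries.X 0 : MvPowerSeries (Fin 3) R) (derivative P) := by
  rw [Derivation.map_aeval, MvPowerSeries.pderiv_X_self, smul_eq_mul, mul_one]

theorem pderiv_aeval_X_of_ne {R : Type*} [CommRing R] (P : R[X]) :
    MvPowerSeries.pderiv R (2 : Fin 3) (aeval (MvPowerSeries.X 0 : MvPowerSeries (Fin 3) R) P) =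
      0 := by
  rw [Derivation.map_aeval, MvPowerSeries.pderiv_X_of_ne (by decide), smul_zero]

/-- The series `G(x) z ^ n`, with `z` the variable standing for `y⁻¹`. -/
noncomputable def polyMul {R : Type*} [CommRing R] (G : R[X]) (n : ℕ) : MvPowerSeries (Fin 3) R :=
  aeval (MvPowerSeries.X 0 : MvPowerSeries (Fin 3) R) G * MvPowerSeries.X 2 ^ n

theorem growthBound_polyMul {R : Type*} [CommRing R] {b : ℕ} (hb : 0 < b) {G : R[X]} {m : ℕ}
    (hG : G.natDegree ≤ m) (n : ℕ) : GrowthBound p (m + n) b (polyMul G n) :=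
  (GrowthBound.aeval_X hb 0 hG).mul hb (GrowthBound.X_pow hb 2 n)

theorem pderiv_zero_polyMul {R : Type*} [CommRing R] (G : R[X]) (n : ℕ) :
    MvPowerSeries.pderiv R (0 : Fin 3) (polyMul G n) = polyMul (derivative G) n := by
  rw [polyMul, Derivation.leibniz, Derivation.leibniz_pow,
    MvPowerSeries.pderiv_X_of_ne (by decide), pderiv_aeval_X, polyMul]
  simp [mul_comm]

theorem pderiv_one_polyMul {R : Type*} [CommRing R] (G : R[X]) (n : ℕ) :
    MvPowerSeries.pderiv R (1 : Fin 3) (polyMul G n) = 0 := by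
  rw [polyMul, Derivation.leibniz, Derivation.leibniz_pow, Derivation.map_aeval,
    MvPowerSeries.pderiv_X_of_ne (by decide), MvPowerSeries.pderiv_X_of_ne (by decide)]
  simp

theorem pderiv_two_polyMul {R : Type*} [CommRing R] (G : R[X]) (n : ℕ) :
    MvPowerSeries.pderiv R (2 : Fin 3) (polyMul G n) = n * polyMul G (n - 1) := by
  rw [polyMul, Derivation.leibniz, Derivation.leibniz_pow,
    MvPowerSeries.pderiv_X_self, pderiv_aeval_X_of_ne, polyMul]
  simp
  ring

/-- The cofactor of `F(x) z ^ r - 1` in the reduction of `S(x) z ^ t`. -/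
noncomputable def reductionCofactor {R : Type*} [CommRing R] (F G η : R[X]) (r n t₀ h : ℕ) :
    MvPowerSeries (Fin 3) R :=
  polyMul (derivative G) n + polyMul η t₀ * ∑ u ∈ Finset.range h, polyMul F r ^ u

theorem growthBound_reductionCofactor {R : Type*} [CommRing R] {b : ℕ} (hb : 0 < b)
    {F G η : R[X]} {d m : ℕ} (hF : F.natDegree ≤ d) (hη : η.natDegree ≤ d) (hG : G.natDegree ≤ m)
    (r n t₀ h : ℕ) :
    GrowthBound p (m + n + (d + t₀ + h * (d + r))) b (reductionCofactor F G η r n t₀ h) := by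
  refine GrowthBound.add (GrowthBound.mono (Nat.le_add_right _ _) le_rfl
    (growthBound_polyMul hb ((natDegree_derivative_le G).trans ((Nat.sub_le _ _).trans hG)) n))
    (GrowthBound.mono (Nat.le_add_left _ _) le_rfl
      ((growthBound_polyMul hb hη t₀).mul hb (GrowthBound.sum hb fun u hu => ?_)))
  refine ((growthBound_polyMul hb hF r).pow hb u).mono (Nat.mul_le_mul_right _ ?_) le_rfl
  exact (Finset.mem_range.1 hu).le

/-- The polynomial identity is multiplied by `z^(n+r)` and `F z^r` is replaced by `1`, once in `G' F
z^(n+r)` and `h` times in `F^h η z^(n+r)`; the latter produces the geometric sum in the cofactor.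
The two derivative terms form the `dx`-coefficient of `d(G z^n)` when `dz = -ρ F' z^(r+1) dx`. -/
theorem reduction_polyMul {R : Type*} [CommRing R] {F G η S : R[X]} {q c ρ : R}
    {r n t₀ h : ℕ} (hS : C q * S = covDeriv F c G + F ^ h * η) (hc : c = n * ρ) (hn : 0 < n)
    (ht : n + r = t₀ + h * r) :
    MvPowerSeries.C q * polyMul S (n + r) = polyMul η t₀ +
      MvPowerSeries.pderiv R (0 : Fin 3) (polyMul G n) -
      MvPowerSeries.C ρ * polyMul (derivative F) (r + 1) *
        MvPowerSeries.pderiv R (2 : Fin 3) (polyMul G n) +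
      (polyMul F r - 1) * reductionCofactor F G η r n t₀ h := by
  have h1 := congrArg (aeval (MvPowerSeries.X 0 : MvPowerSeries (Fin 3) R)) hS
  rw [covDeriv_apply] at h1
  simp only [map_mul, map_add, map_sub, map_pow, aeval_C, MvPowerSeries.algebraMap_apply,
    Algebra.algebraMap_self_apply] at h1
  have h2 := geom_sum_mul (polyMul F r) h
  rw [pderiv_zero_polyMul, pderiv_two_polyMul, reductionCofactor]
  have h3 : MvPowerSeries.C q * polyMul S (n + r) =
      MvPowerSeries.X 2 ^ (n + r) * (MvPowerSeries.C q * aeval (MvPowerSeries.X 0) S) := by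
    rw [polyMul]; ring
  have h4 : polyMul F r ^ h * polyMul η t₀ =
      MvPowerSeries.X 2 ^ (n + r) * (aeval (MvPowerSeries.X 0) F ^ h *
        aeval (MvPowerSeries.X 0) η) := by
    rw [polyMul, polyMul, ht, pow_add]
    ring
  have h5 : (MvPowerSeries.X 2 : MvPowerSeries (Fin 3) R) ^ n =
      MvPowerSeries.X 2 ^ (n - 1) * MvPowerSeries.X 2 := by
    rw [← pow_succ, Nat.sub_add_cancel hn]
  rw [h3, h1, hc, mul_add (MvPowerSeries.X 2 ^ (n + r)), ← h4]
  simp only [map_mul, map_natCast]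
  simp only [polyMul] at h2
  simp only [polyMul, pow_add, pow_one, h5]
  linear_combination (aeval (MvPowerSeries.X 0) η * MvPowerSeries.X 2 ^ t₀) * (-h2)

variable [Fact p.Prime] [Field k] [CharP k p] [Finite k]

/-- A `p`-adically convergent sum of reductions is again a reduction, with overconvergent
primitive and cofactor. -/
theorem exists_overconvergent_reduction {F : (WittVector p k)[X]} {d r t₀ A B : ℕ}
    (hF : F.natDegree = d) {ρ : WittVector p k} (β q c : ℕ → WittVector p k)
    (S G η : ℕ → (WittVector p k)[X]) (n h : ℕ → ℕ)
    (hS : ∀ s, C (q s) * S s = covDeriv F (c s) (G s) + F ^ h s * η s)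
    (hc : ∀ s, c s = n s * ρ) (hn : ∀ s, 0 < n s) (ht : ∀ s, n s + r = t₀ + h s * r)
    (hη : ∀ s, (η s).natDegree < d - 1) (hG : ∀ s, (G s).natDegree ≤ A + B * s)
    (hh : ∀ s, h s ≤ A + B * s) {f : MvPowerSeries (Fin 3) (WittVector p k)}
    (hf : HasPadicSum p (fun s => (p : MvPowerSeries (Fin 3) (WittVector p k)) ^ (s / 2) *
      (MvPowerSeries.C (β s * q s) * polyMul (S s) (n s + r))) f) :
    ∃ e : ℕ → WittVector p k, ∃ g Q : MvPowerSeries (Fin 3) (WittVector p k),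
      Overconvergent p g ∧ Overconvergent p Q ∧ MvPowerSeries.pderiv _ (1 : Fin 3) g = 0 ∧
      f = polyMul (∑ i ∈ Finset.range (d - 1), C (e i) * X ^ i) t₀ +
        MvPowerSeries.pderiv _ (0 : Fin 3) g -
        MvPowerSeries.C ρ * polyMul (derivative F) (r + 1) *
          MvPowerSeries.pderiv _ (2 : Fin 3) g +
        (polyMul F r - 1) * Q := by
  choose e he using fun i => exists_hasPadicSum_witt fun s => β s * (η s).coeff i
  obtain ⟨g, hg⟩ := exists_hasPadicSum_mvPowerSeries fun s =>
    MvPowerSeries.C (β s) * polyMul (G s) (n s)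
  obtain ⟨Q, hQ⟩ := exists_hasPadicSum_mvPowerSeries fun s =>
    MvPowerSeries.C (β s) * reductionCofactor F (G s) (η s) r (n s) t₀ (h s)
  have hns : ∀ s, n s ≤ t₀ + r * (A + B * s) := fun s => by
    have h1 := ht s
    have h2 := Nat.mul_le_mul_left r (hh s)
    rw [mul_comm] at h1
    nlinarith
  set A' := (A + (t₀ + r * A)) + (d + t₀ + A * (d + r)) with hA'
  set B' := (B + r * B) + B * (d + r) + 1 with hB'
  have hlin : ∀ s, A + B * s + n s + (d + t₀ + h s * (d + r)) ≤ A' + B' * s := fun s => by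
    have h1 := hns s
    have h2 := Nat.mul_le_mul_right (d + r) (hh s)
    rw [hA', hB']
    nlinarith
  -- The degree of the `s`-th term is linear in `s` and the term carries `p^⌊s/2⌋`, whence the slope
  -- `2 B'`.
  have hbig : ∀ s, A' + B' * s ≤ (A' + B') + 2 * B' * (s / 2) := fun s => by
    have : s ≤ 1 + 2 * (s / 2) := by omega
    have := Nat.mul_le_mul_left B' this
    rw [mul_add, ← mul_assoc, mul_comm B' 2] at this
    omega
  have hb : 0 < 2 * B' := by omega
  have hgo : Overconvergent p g := ⟨A' + B', 2 * B', hg.growthBound hb fun s =>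
    GrowthBound.pow_mul (((growthBound_polyMul hb (hG s) (n s)).mono
      ((Nat.le_add_right _ _).trans (hlin s)) le_rfl).C_mul _) (hbig s)⟩
  have hQo : Overconvergent p Q := ⟨A' + B', 2 * B', hQ.growthBound hb fun s =>
    GrowthBound.pow_mul (((growthBound_reductionCofactor hb hF.le
      (show (η s).natDegree ≤ d by have := hη s; omega) (hG s) r (n s) t₀ (h s)).mono
      (hlin s) le_rfl).C_mul _) (hbig s)⟩
  have hD : ∀ (i : Fin 3) (s : ℕ), MvPowerSeries.pderiv (WittVector p k) i
      ((p : MvPowerSeries (Fin 3) (WittVector p k)) ^ (s / 2) *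
        (MvPowerSeries.C (β s) * polyMul (G s) (n s))) =
      MvPowerSeries.C ((p : WittVector p k) ^ (s / 2) * β s) *
        MvPowerSeries.pderiv (WittVector p k) i (polyMul (G s) (n s)) := fun i s => by
    have hp2 : (p : MvPowerSeries (Fin 3) (WittVector p k)) ^ (s / 2) =
      MvPowerSeries.C ((p : WittVector p k) ^ (s / 2)) := by simp
    rw [hp2, ← mul_assoc, ← map_mul, Derivation.leibniz, MvPowerSeries.pderiv_C, smul_zero,
      add_zero, smul_eq_mul]
  have hg1 : MvPowerSeries.pderiv (WittVector p k) (1 : Fin 3) g = 0 := by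
    refine (hg.map (MvPowerSeries.pderiv (WittVector p k)
      (1 : Fin 3)).toLinearMap.toAddMonoidHom).unique fun n => ?_
    rw [Finset.sum_eq_zero, sub_zero]
    · exact dvd_zero _
    · intro s _
      change MvPowerSeries.pderiv (WittVector p k) (1 : Fin 3) _ = 0
      rw [hD, pderiv_one_polyMul, mul_zero]
  -- Both sides are `p`-adic sums, so it is enough to match them term by term, where
  -- `reduction_polyMul` applies.
  refine ⟨e, g, Q, hgo, hQo, hg1, hf.unique ?_⟩
  have hη' : HasPadicSum p (fun s => polyMul (∑ i ∈ Finset.range (d - 1),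
      C ((p : WittVector p k) ^ (s / 2) * (β s * (η s).coeff i)) * X ^ i) t₀)
      (polyMul (∑ i ∈ Finset.range (d - 1), C (e i) * X ^ i) t₀) := by
    have h1 := HasPadicSum.sum (Finset.range (d - 1)) (p := p) fun i _ =>
      ((he i).map (C : WittVector p k →+* (WittVector p k)[X]).toAddMonoidHom).map
        (AddMonoidHom.mulRight (X ^ i))
    exact h1.map ((AddMonoidHom.mulRight (MvPowerSeries.X 2 ^ t₀)).comp
      (aeval (MvPowerSeries.X 0 : MvPowerSeries (Fin 3) (WittVector p k))).toAddMonoidHom)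
  have hg0 := hg.map (MvPowerSeries.pderiv (WittVector p k) (0 : Fin 3)).toLinearMap.toAddMonoidHom
  have hg2 := (hg.map (MvPowerSeries.pderiv (WittVector p k)
    (2 : Fin 3)).toLinearMap.toAddMonoidHom).mul_left
      (MvPowerSeries.C ρ * polyMul (derivative F) (r + 1))
  convert ((hη'.add hg0).sub hg2).add (hQ.mul_left (polyMul F r - 1)) using 1
  swap
  · rfl
  funext s
  have hp2 : (p : MvPowerSeries (Fin 3) (WittVector p k)) ^ (s / 2) =
    MvPowerSeries.C ((p : WittVector p k) ^ (s / 2)) := by simp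
  have hηs : polyMul (∑ i ∈ Finset.range (d - 1),
      C ((p : WittVector p k) ^ (s / 2) * (β s * (η s).coeff i)) * X ^ i) t₀ =
      MvPowerSeries.C ((p : WittVector p k) ^ (s / 2) * β s) * polyMul (η s) t₀ := by
    conv_rhs => rw [(η s).as_sum_range_C_mul_X_pow' (hη s)]
    simp only [polyMul, map_sum, map_mul, aeval_C, MvPowerSeries.algebraMap_apply,
      Algebra.algebraMap_self_apply, Finset.sum_mul, Finset.mul_sum, ← mul_assoc]
  have key := reduction_polyMul (hS s) (hc s) (hn s) (ht s)
  change _ = _ + MvPowerSeries.pderiv (WittVector p k) 0 _ -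
    _ * MvPowerSeries.pderiv (WittVector p k) 2 _ + _
  rw [hηs, hD, hD, hp2]
  simp only [map_mul]
  linear_combination (MvPowerSeries.C ((p : WittVector p k) ^ (s / 2)) *
    MvPowerSeries.C (β s)) * key

end ReductionSeries

/-! ### Differentials of `A†` in terms of `dx`. -/

section DaggerCalculus

open Polynomial

variable (p : ℕ) {R : Type*} [CommRing R] (r : ℕ) (F : R[X])

theorem partialDeriv_coord (i l : Fin 3) :
    partialDeriv p R i (coord p R l) = if i = l then 1 else 0 := by
  apply Subtype.ext
  change MvPowerSeries.pderiv R i (MvPowerSeries.X l) = _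
  split_ifs with h
  · rw [h, MvPowerSeries.pderiv_X_self]
    rfl
  · rw [MvPowerSeries.pderiv_X_of_ne (Ne.symm h)]
    rfl

theorem gradient_coord (i : Fin 3) : gradient p r F (coord p R i) = Pi.single i 1 := by
  classical
  funext l
  change toDagger p r F (partialDeriv p R l (coord p R i)) = _
  rw [partialDeriv_coord, Pi.single_apply]
  split_ifs <;> simp

/-- The total differential in coordinates. -/
theorem exteriorD_eq_sum (f : overconvergentSeries p R) :
    exteriorD p r F (toDagger p r F f) = ∑ i, toDagger p r F (partialDeriv p R i f) •
      exteriorD p r F (toDagger p r F (coord p R i)) := by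
  simp_rw [exteriorD_toDagger, gradient_coord, ← map_smul, ← map_sum]
  congr 1
  funext l
  rw [Finset.sum_apply, Finset.sum_eq_single l]
  · simp [gradient]
  · intro i _ hi
    simp [Pi.single_eq_of_ne hi.symm]
  · simp

theorem coe_aeval_coord (P : R[X]) (i : Fin 3) :
    ((aeval (coord p R i) P : overconvergentSeries p R) : MvPowerSeries (Fin 3) R) =
      aeval (MvPowerSeries.X i) P :=
  (aeval_algHom_apply (overconvergentSeries p R).val (coord p R i) P).symm

theorem toDagger_aeval (P : R[X]) :
    toDagger p r F (aeval (coord p R 0) P) = aeval (xFun p r F) P :=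
  (aeval_algHom_apply (toDagger p r F) (coord p R 0) P).symm

theorem exteriorD_aeval (P : R[X]) : exteriorD p r F (aeval (xFun p r F) P) =
    aeval (xFun p r F) (derivative P) • exteriorD p r F (xFun p r F) := by
  have h : ∀ i : Fin 3, partialDeriv p R i (aeval (coord p R 0) P) =
      if i = 0 then aeval (coord p R 0) (derivative P) else 0 := fun i => by
    apply Subtype.ext
    change MvPowerSeries.pderiv R i
      ((aeval (coord p R 0) P : overconvergentSeries p R) : MvPowerSeries (Fin 3) R) = _
    rw [coe_aeval_coord, Derivation.map_aeval]
    split_ifs with h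
    · rw [h, MvPowerSeries.pderiv_X_self, coe_aeval_coord, smul_eq_mul, mul_one]
    · rw [MvPowerSeries.pderiv_X_of_ne (Ne.symm h), smul_zero]
      rfl
  rw [← toDagger_aeval, exteriorD_eq_sum, Finset.sum_eq_single 0]
  · rw [h, if_pos rfl, toDagger_aeval]
    rfl
  · intro i _ hi
    rw [h, if_neg hi, map_zero, zero_smul]
  · simp

/-- The function `y` in `A†`. -/
noncomputable def yFun : Dagger p r F := toDagger p r F (coord p R 1)

theorem yFun_mul_yInv : yFun p r F * yInv p r F = 1 := by
  rw [yFun, yInv, ← map_mul, ← map_one (toDagger p r F)]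
  exact (toDagger_eq_iff p r F).2 (Ideal.subset_span (Or.inl rfl))

theorem yFun_pow : yFun p r F ^ r = aeval (xFun p r F) F := by
  rw [yFun, ← map_pow, ← toDagger_aeval]
  exact (toDagger_eq_iff p r F).2 (Ideal.subset_span (Or.inr rfl))

theorem aeval_mul_yInv_pow : aeval (xFun p r F) F * yInv p r F ^ r = 1 := by
  rw [← yFun_pow, ← mul_pow, yFun_mul_yInv, one_pow]

theorem yInv_smul_exteriorD_yFun : yInv p r F • exteriorD p r F (yFun p r F) +
    yFun p r F • exteriorD p r F (yInv p r F) = 0 := by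
  have h0 : exteriorD p r F (toDagger p r F 1) = 0 := by
    have := exteriorD_aeval p r F (1 : R[X])
    simpa using this
  have h1 : exteriorD p r F (toDagger p r F (coord p R 1 * coord p R 2)) =
      exteriorD p r F (toDagger p r F 1) := by
    rw [map_mul, map_one]
    exact congrArg _ (yFun_mul_yInv p r F)
  rw [h0, exteriorD_eq_sum, Fin.sum_univ_three] at h1
  have e : ∀ i : Fin 3, partialDeriv p R i (coord p R 1 * coord p R 2) =
      coord p R 1 * partialDeriv p R i (coord p R 2) +
      coord p R 2 * partialDeriv p R i (coord p R 1) := fun i =>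
    Subtype.ext ((MvPowerSeries.pderiv R i).leibniz _ _)
  simp only [e, partialDeriv_coord] at h1
  simpa [yFun, yInv] using h1

theorem pow_smul_exteriorD_yFun : (r * yFun p r F ^ (r - 1)) • exteriorD p r F (yFun p r F) =
    aeval (xFun p r F) (derivative F) • exteriorD p r F (xFun p r F) := by
  have e : ∀ i : Fin 3, partialDeriv p R i (coord p R 1 ^ r) =
      if i = 1 then (r : overconvergentSeries p R) * coord p R 1 ^ (r - 1) else 0 := fun i => by
    apply Subtype.ext
    change MvPowerSeries.pderiv R i (MvPowerSeries.X 1 ^ r) = _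
    rw [Derivation.leibniz_pow]
    split_ifs with h
    · rw [h, MvPowerSeries.pderiv_X_self, smul_eq_mul, mul_one, nsmul_eq_mul]
      rfl
    · rw [MvPowerSeries.pderiv_X_of_ne (Ne.symm h), smul_zero, smul_zero]
      rfl
  rw [← exteriorD_aeval, ← yFun_pow]
  symm
  rw [yFun, ← map_pow, exteriorD_eq_sum, Finset.sum_eq_single 1]
  · rw [e, if_pos rfl, map_mul, map_natCast, map_pow]
  · intro i _ hi
    rw [e, if_neg hi, map_zero, zero_smul]
  · simp

/-- On `y ^ r = F(x)` with `r` invertible, `d(y⁻¹) = -(1 / r) F'(x) y ^ (-(r + 1)) dx`. -/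
theorem exteriorD_yInv {ρ : R} (hr : 0 < r) (hρ : r * ρ = 1) : exteriorD p r F (yInv p r F) =
    (-(algebraMap R (Dagger p r F) ρ * aeval (xFun p r F) (derivative F) * yInv p r F ^ (r + 1))) •
      exteriorD p r F (xFun p r F) := by
  have hyz := yFun_mul_yInv p r F
  have h1 := yInv_smul_exteriorD_yFun p r F
  have h2 := pow_smul_exteriorD_yFun p r F
  have hρ' : (r : Dagger p r F) * algebraMap R (Dagger p r F) ρ = 1 := by
    rw [← map_natCast (algebraMap R (Dagger p r F)), ← map_mul, hρ, map_one]
  have h3 : yFun p r F ^ (r - 1) * yInv p r F ^ (r - 1) = 1 := by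
    rw [← mul_pow, hyz, one_pow]
  have hpow : yInv p r F ^ (r + 1) = yInv p r F ^ (r - 1) * yInv p r F ^ 2 := by
    rw [← pow_add]
    congr 1
    omega
  set Y := yFun p r F
  set Z := yInv p r F
  set ρ' := algebraMap R (Dagger p r F) ρ
  have h4 : exteriorD p r F Z = -((Z * Z) • exteriorD p r F Y) := by
    have h5 : Z • (Z • exteriorD p r F Y + Y • exteriorD p r F Z) = 0 := by rw [h1, smul_zero]
    rw [smul_add, smul_smul, smul_smul, mul_comm Z Y, hyz, one_smul] at h5
    exact eq_neg_of_add_eq_zero_right h5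
  have h6 : exteriorD p r F Y = (ρ' * Z ^ (r - 1)) • (r * Y ^ (r - 1)) • exteriorD p r F Y := by
    rw [smul_smul]
    have : ρ' * Z ^ (r - 1) * (r * Y ^ (r - 1)) = 1 := by
      linear_combination (Y ^ (r - 1) * Z ^ (r - 1)) * hρ' + h3
    rw [this, one_smul]
  rw [h4, h6, h2, smul_smul, smul_smul, ← neg_smul, hpow]
  congr 1
  ring

/-- The primitives built above involve only `x` and `y⁻¹`, so the formula for `d(y⁻¹)` alone puts
their differentials in the shape produced by `reduction_polyMul`. -/
theorem exteriorD_of_partialDeriv_one_eq_zero {ρ : R} (hr : 0 < r) (hρ : r * ρ = 1)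
    {g : overconvergentSeries p R} (hg : partialDeriv p R 1 g = 0) :
    exteriorD p r F (toDagger p r F g) = (toDagger p r F (partialDeriv p R 0 g) -
      algebraMap R (Dagger p r F) ρ * aeval (xFun p r F) (derivative F) * yInv p r F ^ (r + 1) *
        toDagger p r F (partialDeriv p R 2 g)) • exteriorD p r F (xFun p r F) := by
  rw [exteriorD_eq_sum, Fin.sum_univ_three, hg, map_zero, zero_smul, add_zero]
  change _ + _ • exteriorD p r F (yInv p r F) = _
  rw [exteriorD_yInv p r F hr hρ, smul_smul, sub_smul, sub_eq_add_neg, ← neg_smul]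
  congr 2
  ring

end DaggerCalculus

/-! ### The Frobenius series, its truncation and its tail. -/

section FrobeniusExpansion

open Polynomial

theorem pow_dvd_subst_sub_sum {R : Type*} [CommRing R] {a : MvPowerSeries (Fin 3) R}
    (ha : PowerSeries.HasSubst a) (φ : PowerSeries R) (n : ℕ) :
    a ^ n ∣ PowerSeries.subst a φ -
      ∑ m ∈ Finset.range n, MvPowerSeries.C (PowerSeries.coeff m φ) * a ^ m := by
  have h1 := congrArg (PowerSeries.substAlgHom ha) (φ.eq_X_pow_mul_shift_add_trunc n)
  rw [map_add, map_mul, map_pow, PowerSeries.substAlgHom_X] at h1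
  have h2 : PowerSeries.substAlgHom ha (φ.trunc n : PowerSeries R) =
      ∑ m ∈ Finset.range n, MvPowerSeries.C (PowerSeries.coeff m φ) * a ^ m := by
    rw [PowerSeries.substAlgHom_coe, aeval_def, PowerSeries.eval₂_trunc_eq_sum_range]
    refine Finset.sum_congr rfl fun m _ => ?_
    rw [MvPowerSeries.algebraMap_apply, Algebra.algebraMap_self_apply]
  rw [h2, PowerSeries.coe_substAlgHom] at h1
  rw [h1, add_sub_cancel_right]
  exact dvd_mul_right _ _

variable {p : ℕ} [Fact p.Prime] {k : Type*} [Field k] [CharP k p]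

theorem natDegree_le_of_frobPoly_sub {F E : (WittVector p k)[X]} {d : ℕ} (hF : F.natDegree = d)
    (hE : frobPoly p F - F ^ p = (p : WittVector p k) • E) : E.natDegree ≤ p * d := by
  have h1 : (frobPoly p F - F ^ p).natDegree ≤ p * d := by
    refine (natDegree_sub_le _ _).trans (max_le ?_ ?_)
    · rw [frobPoly, natDegree_expand, mul_comm]
      exact Nat.mul_le_mul_left _ (natDegree_map_le.trans hF.le)
    · exact natDegree_pow_le_of_le p hF.le
  rwa [hE, smul_eq_C_mul, natDegree_C_mul natCast_p_ne_zero_witt] at h1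

theorem aeval_frobPoly_pow {A : Type*} [CommRing A] [Algebra (WittVector p k) A] (x : A)
    {F : (WittVector p k)[X]} {d : ℕ} (hF : F.natDegree = d) (l : ℕ) :
    aeval x (frobPoly p F ^ l) =
      ∑ b ∈ Finset.range (d * l + 1), (frobPoly p F ^ l).coeff (p * b) • x ^ (p * b) := by
  have h1 : frobPoly p F ^ l =
      expand (WittVector p k) p ((F.map WittVector.frobenius) ^ l) := by
    rw [frobPoly, map_pow]
  have h2 : ((F.map (WittVector.frobenius : WittVector p k →+* _)) ^ l).natDegree < d * l + 1 := by
    have := natDegree_pow_le_of_le l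
      (natDegree_map_le (f := (WittVector.frobenius : WittVector p k →+* _)) (p := F))
    rw [hF, mul_comm] at this
    omega
  rw [h1, expand_aeval, aeval_eq_sum_range' h2]
  refine Finset.sum_congr rfl fun b _ => ?_
  rw [mul_comm p b, coeff_expand_mul (Fact.out : p.Prime).pos, mul_comm b p, pow_mul]

theorem card_termIndex (N d : ℕ) : (termIndex N d).card = N + d * N.choose 2 := by
  rw [termIndex, Finset.card_sigma]
  simp only [Finset.card_range]
  rw [Finset.sum_add_distrib, ← Finset.mul_sum, Finset.sum_range_id, Nat.choose_two_right]
  simp [add_comm]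

-- Expanding `(x - 1)^m` binomially and exchanging the sums is where the numbers `D_{j,ℓ}` come
-- from; it is applied with `x = σ(F) y^(-pr)`.
variable (k) in
theorem sum_mul_sub_one_pow {A : Type*} [CommRing A] [Algebra (WittVector p k) A]
    (r N j : ℕ) (x : A) :
    ∑ m ∈ Finset.range N, algebraMap (WittVector p k) A (padicToWitt p k (binomPadic p r j m)) *
      (x - 1) ^ m = ∑ l ∈ Finset.range N, algebraMap _ A (coeffD p k r N j l) * x ^ l := by
  simp only [coeffD, sub_eq_add_neg, add_pow, Finset.mul_sum, map_sum, Finset.sum_mul]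
  rw [Finset.sum_comm' (t' := Finset.range N) (s' := fun l => Finset.Ico l N)]
  · refine Finset.sum_congr rfl fun l _ => Finset.sum_congr rfl fun m _ => ?_
    simp only [map_mul, map_pow, map_neg, map_one, map_natCast]
    ring
  · intro m l
    simp only [Finset.mem_range, Finset.mem_Ico]
    omega

variable [Finite k] (F : (WittVector p k)[X]) {r : ℕ}

/-- The summand `F^p y^(-pr)` is `1` on the curve; removing it eliminates the dense polynomial `F^p`
and leaves only exponents of `x` divisible by `p`. -/
theorem toDagger_frobCorrection : toDagger p r F (frobCorrection F r) =
    aeval (xFun p r F) (frobPoly p F) * yInv p r F ^ (p * r) - 1 := by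
  have h : aeval (xFun p r F) F ^ p * yInv p r F ^ (p * r) = 1 := by
    rw [mul_comm p r, pow_mul, ← mul_pow, aeval_mul_yInv_pow, one_pow]
  rw [frobCorrection, map_mul, toDagger_aeval, map_pow, map_sub, map_pow, sub_mul]
  change _ - _ * yInv p r F ^ (p * r) = _
  rw [h]
  rfl

/-- The truncation of the Frobenius series is the sparse differential. -/
theorem sparseForm_eq {d : ℕ} (hF : F.natDegree = d) (N i j : ℕ) :
    sparseForm p F r d N i j = (p * xFun p r F ^ (p * (i + 1) - 1) * yInv p r F ^ (j * p) *
      toDagger p r F (∑ m ∈ Finset.range N,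
        algebraMap _ _ (padicToWitt p k (binomPadic p r j m)) * frobCorrection F r ^ m)) •
      exteriorD p r F (xFun p r F) := by
  have key : ∑ t ∈ termIndex N d, coeffMu p F r N j t.1 t.2 •
      (xFun p r F ^ (p * t.2) * yInv p r F ^ (t.1 * p * r)) =
      p * ∑ l ∈ Finset.range N, algebraMap _ (Dagger p r F) (coeffD p k r N j l) *
        (aeval (xFun p r F) (frobPoly p F) * yInv p r F ^ (p * r)) ^ l := by
    rw [termIndex, Finset.sum_sigma, Finset.mul_sum]
    refine Finset.sum_congr rfl fun l _ => ?_
    rw [mul_pow, ← map_pow, aeval_frobPoly_pow _ hF, Finset.sum_mul, Finset.mul_sum,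
      Finset.mul_sum]
    refine Finset.sum_congr rfl fun b _ => ?_
    simp only [coeffMu, Algebra.smul_def, map_mul, map_natCast]
    rw [← pow_mul, show p * r * l = l * p * r by ring]
    ring
  rw [sparseForm, key, map_sum]
  simp only [map_mul, map_pow, AlgHom.commutes, toDagger_frobCorrection]
  rw [sum_mul_sub_one_pow k]
  refine congrArg (fun y => y • _) ?_
  ring

theorem frob_xFun (hpr : ¬ p ∣ r) : frob F hpr (xFun p r F) = xFun p r F ^ p := by
  rw [xFun, frob_toDagger, frobSeries_coord, ← map_pow]
  rfl

/-- The factor `p` and the exponent `p(i+1) - 1` come from `d(x^p) = p x^(p-1) dx`; this `p` is the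
extra one in the precision count. -/
theorem frobForm_eq (hpr : ¬ p ∣ r) (i j : ℕ) :
    frobForm F hpr (xFun p r F ^ i * yInv p r F ^ j) (xFun p r F) =
      (p * xFun p r F ^ (p * (i + 1) - 1) * yInv p r F ^ (j * p) *
        toDagger p r F (frobUnit F r (pos_of_not_dvd hpr) j)) •
        exteriorD p r F (xFun p r F) := by
  have h := exteriorD_aeval p r F (X ^ p : (WittVector p k)[X])
  simp only [map_pow, aeval_X, derivative_X_pow, map_mul, map_natCast] at h
  rw [frobForm, map_mul, map_pow, frob_xFun, frob_yInv_pow, h, smul_smul]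
  congr 1
  have hp := (Fact.out : p.Prime).pos
  rw [show p * (i + 1) - 1 = p * i + (p - 1) by rw [mul_add, mul_one]; omega, pow_add, pow_mul]
  ring

theorem coe_frobCorrection {E : (WittVector p k)[X]}
    (hE : frobPoly p F - F ^ p = (p : WittVector p k) • E) :
    (frobCorrection F r : MvPowerSeries (Fin 3) (WittVector p k)) = p * polyMul E (p * r) := by
  have : frobCorrection F r = p * (aeval (coord p (WittVector p k) 0) E *
      coord p (WittVector p k) 2 ^ (p * r)) := by
    rw [frobCorrection, hE, smul_eq_C_mul, map_mul, aeval_C, map_natCast, mul_assoc]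
  rw [this]
  change (p : MvPowerSeries (Fin 3) (WittVector p k)) *
    (((aeval (coord p (WittVector p k) 0) E : overconvergentSeries p (WittVector p k)) :
      MvPowerSeries (Fin 3) (WittVector p k)) * MvPowerSeries.X 2 ^ (p * r)) = _
  rw [coe_aeval_coord, polyMul]

/-- The tail of the Frobenius series, divided by `p ^ N`, as a `p`-adic sum. -/
theorem exists_frobUnit_tail {E : (WittVector p k)[X]}
    (hE : frobPoly p F - F ^ p = (p : WittVector p k) • E) (hr : 0 < r) (N e j : ℕ) :
    ∃ f : MvPowerSeries (Fin 3) (WittVector p k),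
      HasPadicSum p (fun s => (p : MvPowerSeries (Fin 3) (WittVector p k)) ^ (s / 2) *
        (MvPowerSeries.C (padicToWitt p k (binomPadic p r j (N + s)) *
          (p : WittVector p k) ^ (1 + (s + 1) / 2)) *
          polyMul (E ^ (N + s) * X ^ e) (p * (j + (N + s) * r)))) f ∧
      (p : MvPowerSeries (Fin 3) (WittVector p k)) * polyMul (X ^ e) (j * p) *
        ((frobUnit F r hr j - ∑ m ∈ Finset.range N, algebraMap _ _
          (padicToWitt p k (binomPadic p r j m)) * frobCorrection F r ^ m :
            overconvergentSeries p (WittVector p k)) :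
              MvPowerSeries (Fin 3) (WittVector p k)) =
          (p : MvPowerSeries (Fin 3) (WittVector p k)) ^ N * f := by
  set b := fun m => padicToWitt p k (binomPadic p r j m) with hb
  obtain ⟨f, hf⟩ := exists_hasPadicSum_mvPowerSeries fun s =>
    MvPowerSeries.C (b (N + s) * (p : WittVector p k) ^ (1 + (s + 1) / 2)) *
      polyMul (E ^ (N + s) * X ^ e) (p * (j + (N + s) * r))
  refine ⟨f, hf, ?_⟩
  set a : MvPowerSeries (Fin 3) (WittVector p k) :=
    (frobCorrection F r).1 with ha
  set U : MvPowerSeries (Fin 3) (WittVector p k) :=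
    (p : MvPowerSeries (Fin 3) (WittVector p k)) * polyMul (X ^ e) (j * p) with hU
  have hcoe : ((frobUnit F r hr j - ∑ m ∈ Finset.range N, algebraMap _ _ (b m) *
      frobCorrection F r ^ m : overconvergentSeries p (WittVector p k)) :
        MvPowerSeries (Fin 3) (WittVector p k)) =
      PowerSeries.subst a (binomSeries p k r j) -
        ∑ m ∈ Finset.range N, MvPowerSeries.C (b m) * a ^ m := by
    rw [AddSubgroupClass.coe_sub, AddSubmonoidClass.coe_finsetSum]
    rfl
  have haE : a = p * polyMul E (p * r) := coe_frobCorrection F hE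
  have htail : HasPadicSum p (fun s => MvPowerSeries.C (b (N + s)) * a ^ (N + s))
      (PowerSeries.subst a (binomSeries p k r j) -
        ∑ m ∈ Finset.range N, MvPowerSeries.C (b m) * a ^ m) := fun n => by
    -- Cutting after `N + 2n` terms leaves a multiple of `a^(N+2n)`, and `p` divides `a`.
    have h1 := pow_dvd_subst_sub_sum (hasSubst_frobCorrection F r hr) (binomSeries p k r j)
      (N + 2 * n)
    simp only [binomSeries, PowerSeries.coeff_mk] at h1
    rw [Finset.sum_range_add, ← sub_sub] at h1
    refine Dvd.dvd.trans ?_ h1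
    rw [← ha, haE, mul_pow]
    exact (pow_dvd_pow _ (by omega)).mul_right _
  rw [hcoe]
  refine (htail.mul_left U).unique ?_
  convert hf.mul_left ((p : MvPowerSeries (Fin 3) (WittVector p k)) ^ N) using 1
  funext s
  -- The precision budget: `N` is kept for the congruence, `s / 2` for convergence, and `1 + (s + 1)
  -- / 2` pays for the denominators of the reduction.
  have hs : N + s + 1 = N + s / 2 + (1 + (s + 1) / 2) := by omega
  have hpp : (p : MvPowerSeries (Fin 3) (WittVector p k)) ^ (N + s) * p =
      p ^ N * p ^ (s / 2) * p ^ (1 + (s + 1) / 2) := by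
    rw [← pow_succ, hs, pow_add, pow_add]
  have hmul : polyMul (X ^ e) (j * p) * polyMul E (p * r) ^ (N + s) =
      polyMul (E ^ (N + s) * X ^ e) (p * (j + (N + s) * r)) := by
    simp only [polyMul, map_mul, map_pow]
    ring
  rw [hU, haE, mul_pow, ← hmul]
  simp only [map_mul, map_pow, map_natCast]
  linear_combination (MvPowerSeries.C (b (N + s)) * polyMul (X ^ e) (j * p) *
    polyMul E (p * r) ^ (N + s)) * hpp

end FrobeniusExpansion

/-! ### Arithmetic consequences of the lower bound on `p`. -/

section CriticalRange

/-- In the range of degrees that has to be reduced, the leading coefficients do not vanish and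
are smaller than `p ^ 2`. -/
theorem criticalRange {p r d N i j ε j₀ h' K m : ℕ} (hε : ε = 0 ∨ ε = 1) (hN : 0 < N)
    (hi : i + 2 ≤ d) (hj : ε * r + 1 ≤ j) (hj₀ : 1 ≤ j₀) (hj₀' : j₀ + 1 ≤ r)
    (hp : d * (N + ε) * r < p) (hpj : p * j = j₀ + ε * r + h' * r)
    (hm : d * (h' + p * K) ≤ m) (hm' : m + d ≤ p * d * K + p * (i + 1)) :
    (m * r + d * r - d * (p * ((j + K * r : ℕ) : ℤ)) : ℤ) ≠ 0 ∧
      |(m * r + d * r - d * (p * ((j + K * r : ℕ) : ℤ)) : ℤ)| < p ^ 2 := by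
  have hdr : d * r < p := by
    refine lt_of_le_of_lt ?_ hp
    exact Nat.mul_le_mul_right r (Nat.le_mul_of_pos_right d (by omega))
  have h1 : d * (h' + p * K) * r ≤ m * r := Nat.mul_le_mul_right r hm
  have h2 : (m + d) * r ≤ (p * d * K + p * (i + 1)) * r := Nat.mul_le_mul_right r hm'
  have h3 : (i + 1) * r ≤ (d - 1) * r := Nat.mul_le_mul_right r (by omega)
  obtain ⟨d, rfl⟩ : ∃ d', d = d' + 2 := ⟨d - 2, by omega⟩
  rw [show d + 2 - 1 = d + 1 by omega] at h3
  zify at *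
  set e : ℤ := m * r + (d + 2) * r - (d + 2) * (p * (j + K * r)) with he
  -- At the lower end of the range, `h' r = p j - j₀ - ε r` makes all multiples of `p` cancel,
  -- including those containing `K`.
  have hlow : (d + 2) * (r - ε * r - j₀) ≤ e := by
    have : (d + 2 : ℤ) * (p * j) = (d + 2) * (j₀ + ε * r + h' * r) := by rw [hpj]
    rw [he]
    nlinarith
  have hup : e ≤ p * ((i + 1) * r - (d + 2) * j) := by
    rw [he]
    nlinarith
  have hp0 : (0 : ℤ) < p := lt_of_le_of_lt (by positivity) hdr
  have hup' : e ≤ p * ((d + 1) * r - (d + 2) * j) := by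
    refine hup.trans (mul_le_mul_of_nonneg_left ?_ hp0.le)
    linarith
  -- For `ε = 0` the lower bound is positive since `j₀ < r`. For `ε = 1` the upper bound is negative
  -- since `j > r`, and the lower bound becomes `-d j₀ > -p`.
  rcases hε with h | h
  · rw [h] at hlow hj
    have h4 : 0 < e := by nlinarith
    refine ⟨h4.ne', ?_⟩
    rw [abs_of_pos h4, sq]
    refine hup'.trans_lt (mul_lt_mul_of_pos_left ?_ hp0)
    nlinarith
  · rw [h, one_mul] at hlow hj
    have hd0 : (0 : ℤ) ≤ d + 2 := by positivity
    have h4 : e < 0 := by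
      refine hup'.trans_lt (mul_neg_of_pos_of_neg hp0 ?_)
      have := mul_le_mul_of_nonneg_left hj hd0
      linarith
    refine ⟨h4.ne, ?_⟩
    have h5 : -e < p := by
      have := mul_le_mul_of_nonneg_left hj₀' hd0
      linarith
    rw [abs_of_neg h4, sq]
    exact h5.trans_le (le_mul_of_one_le_left hp0.le hp0)

/-- The left side grows linearly in `s` and the right side exponentially: it is at most `2(N+ε)r
(s+1)`, where the first factor is below `p` because `d ≥ 2`, and `s + 1 ≤ p^((s+1)/2)` because `p ≥
4`. -/
theorem lt_pow_of_bound {p r d N j ε s : ℕ} (hε : ε ≤ 1) (hN : 0 < N) (hd : 2 ≤ d)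
    (hr : 2 ≤ r) (hj : j + 1 ≤ (1 + ε) * r) (hp : d * (N + ε) * r < p) :
    j + (N + s) * r < p ^ (1 + (s + 1) / 2) := by
  have hp4 : 4 ≤ p := by
    have : 2 * 1 * 2 ≤ d * (N + ε) * r := by gcongr; omega
    omega
  have h1 : s + 1 ≤ p ^ ((s + 1) / 2) := by
    calc s + 1 ≤ 2 ^ s := Nat.lt_two_pow_self
      _ ≤ 2 ^ (2 * ((s + 1) / 2)) := Nat.pow_le_pow_right (by omega) (by omega)
      _ = 4 ^ ((s + 1) / 2) := by rw [pow_mul]; norm_num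
      _ ≤ p ^ ((s + 1) / 2) := Nat.pow_le_pow_left hp4 _
  have h2 : 2 * (N + ε) * r ≤ d * (N + ε) * r := by gcongr
  calc j + (N + s) * r < (1 + ε) * r + (N + s) * r := by omega
    _ ≤ (2 * (N + ε) * r) * (s + 1) := by
      have : (1 + ε) + (N + s) ≤ 2 * (N + ε) * (s + 1) := by nlinarith
      calc (1 + ε) * r + (N + s) * r = ((1 + ε) + (N + s)) * r := by ring
        _ ≤ (2 * (N + ε) * (s + 1)) * r := Nat.mul_le_mul_right r this
        _ = _ := by ring
    _ ≤ p * p ^ ((s + 1) / 2) := Nat.mul_le_mul (by omega) h1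
    _ = p ^ (1 + (s + 1) / 2) := by rw [pow_add, pow_one]

/-- Pole orders change by multiples of `r`, so the reduction ends at the residue of `p j`, shifted
by `ε r`. The residue is nonzero because `j` lies strictly between consecutive multiples of `r` and
`p` is prime to `r`. -/
theorem exists_residue {p r j ε : ℕ} (hp : p.Prime) (hpr : ¬ p ∣ r)
    (hr : 0 < r) (hj : ε * r + 1 ≤ j) (hj' : j + 1 ≤ (1 + ε) * r) :
    ∃ j₀ h', 1 ≤ j₀ ∧ j₀ + 1 ≤ r ∧ p * j = j₀ + ε * r + h' * r := by
  have h1 : ε ≤ p * j / r := by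
    rw [Nat.le_div_iff_mul_le hr]
    exact (by omega : ε * r ≤ j).trans (Nat.le_mul_of_pos_left j hp.pos)
  refine ⟨p * j % r, p * j / r - ε, ?_, Nat.mod_lt _ hr, ?_⟩
  · rw [Nat.one_le_iff_ne_zero, Ne, ← Nat.dvd_iff_mod_eq_zero]
    intro h
    obtain ⟨c, hc⟩ := ((Nat.Prime.coprime_iff_not_dvd hp).2 hpr).symm.dvd_of_dvd_mul_left h
    rw [hc, mul_comm r c] at hj hj'
    have h2 : ε < c := lt_of_mul_lt_mul_right (by omega : ε * r < c * r) (Nat.zero_le r)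
    have h3 : c < 1 + ε := lt_of_mul_lt_mul_right (by omega : c * r < (1 + ε) * r) (Nat.zero_le r)
    omega
  · have h2 := Nat.mod_add_div' (p * j) r
    obtain ⟨q, hq⟩ := Nat.exists_eq_add_of_le h1
    rw [hq] at h2 ⊢
    rw [Nat.add_sub_cancel_left]
    rw [add_mul] at h2
    linarith

end CriticalRange

/-! ### Reduction of the tail and passage to cohomology. -/

section Main

open Polynomial

variable {p : ℕ} [Fact p.Prime] {k : Type*} [Field k] [CharP k p] [Finite k]

/-- The reduction of the tail of the Frobenius series in the ring of overconvergent series. -/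
theorem exists_tail_reduction {F : (WittVector p k)[X]} {r d N i j ε j₀ h' : ℕ}
    (hF : F.natDegree = d) (hlc : IsUnit F.leadingCoeff) (hsep : F.Separable)
    (hε : ε = 0 ∨ ε = 1) (hN : 0 < N)
    (hi : i + 2 ≤ d) (hj : ε * r + 1 ≤ j) (hj' : j + 1 ≤ (1 + ε) * r)
    (hj₀ : 1 ≤ j₀) (hj₀' : j₀ + 1 ≤ r)
    (hp : d * (N + ε) * r < p) (hpj : p * j = j₀ + ε * r + h' * r) (hpr : ¬ p ∣ r)
    {ρ : WittVector p k} (hρ : r * ρ = 1) :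
    ∃ e : ℕ → WittVector p k, ∃ g Q : MvPowerSeries (Fin 3) (WittVector p k),
      Overconvergent p g ∧ Overconvergent p Q ∧ MvPowerSeries.pderiv _ (1 : Fin 3) g = 0 ∧
      (p : MvPowerSeries (Fin 3) (WittVector p k)) * polyMul (X ^ (p * (i + 1) - 1)) (j * p) *
        ((frobUnit F r (pos_of_not_dvd hpr) j - ∑ m ∈ Finset.range N, algebraMap _ _
          (padicToWitt p k (binomPadic p r j m)) * frobCorrection F r ^ m :
            overconvergentSeries p (WittVector p k)) :
              MvPowerSeries (Fin 3) (WittVector p k)) =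
      (p : MvPowerSeries (Fin 3) (WittVector p k)) ^ N *
        (polyMul (∑ l ∈ Finset.range (d - 1), C (e l) * X ^ l) (j₀ + ε * r) +
        MvPowerSeries.pderiv _ (0 : Fin 3) g -
        MvPowerSeries.C ρ * polyMul (derivative F) (r + 1) *
          MvPowerSeries.pderiv _ (2 : Fin 3) g +
        (polyMul F r - 1) * Q) := by
  obtain ⟨E, hE⟩ := exists_frobPoly_sub_pow F
  obtain ⟨f, hf, hfeq⟩ := exists_frobUnit_tail F hE (pos_of_not_dvd hpr) N (p * (i + 1) - 1) j
  have hp0 : 0 < p := (Fact.out : p.Prime).pos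
  have hpi : 0 < p * (i + 1) := Nat.mul_pos hp0 i.succ_pos
  have hτ : ∀ s, p * (j + (N + s) * r) = (j₀ + ε * r) + (h' + p * (N + s)) * r := fun s => by
    rw [mul_add, hpj]
    ring
  have hred : ∀ s, ∃ G η : (WittVector p k)[X],
      C ((p : WittVector p k) ^ (1 + (s + 1) / 2)) * (E ^ (N + s) * X ^ (p * (i + 1) - 1)) =
        covDeriv F (p * (j + (N + s) * r : ℕ) * ρ - 1) G + F ^ (h' + p * (N + s)) * η ∧
      η.natDegree < d - 1 ∧ G.natDegree ≤ max (d * (h' + p * (N + s)))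
        (p * d * (N + s) + p * (i + 1) - 1) := fun s => by
    -- The degree bound is `p d (N+s)` from `E^(N+s)` plus the exponent of `x`; its top is exactly
    -- the upper end admitted by `criticalRange`.
    refine exists_reduction hF (by omega) hlc hsep hρ hpr (hτ s) (by omega) ?_ (by omega)
      (lt_pow_of_bound (by omega) hN (by omega) (by omega) hj' hp) (fun m hm hm' => ?_) _ ?_
    · exact (Nat.le_mul_of_pos_right p (by omega)).trans (Nat.le_add_left _ _)
    · exact criticalRange hε hN hi hj hj₀ hj₀' hp hpj hm (by omega)
    · have h1 := natDegree_pow_le_of_le (N + s) (natDegree_le_of_frobPoly_sub hF hE)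
      have h2 := natDegree_mul_le (p := E ^ (N + s))
        (q := (X ^ (p * (i + 1) - 1) : (WittVector p k)[X]))
      have h3 := natDegree_X_pow_le (R := WittVector p k) (p * (i + 1) - 1)
      rw [mul_comm (N + s)] at h1
      omega
  choose G η hGη hη hG using hred
  have hr0 : 0 < r := pos_of_not_dvd hpr
  have hn : ∀ s, r < p * (j + (N + s) * r) := fun s => by
    rw [hτ]
    have : 1 * r ≤ (h' + p * (N + s)) * r := by
      refine Nat.mul_le_mul_right r ?_
      have := Nat.mul_pos hp0 (show 0 < N + s by omega)
      omega
    omega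
  have hnr : ∀ s, p * (j + (N + s) * r) - r + r = p * (j + (N + s) * r) := fun s =>
    Nat.sub_add_cancel (hn s).le
  have hlin : ∀ s, d * (h' + p * (N + s)) + (p * d * (N + s) + p * (i + 1)) =
      (d * h' + 2 * d * p * N + p * (i + 1)) + 2 * d * p * s := fun s => by ring
  obtain ⟨e, g, Q, hg, hQ, hg1, hfe⟩ := exists_overconvergent_reduction (r := r)
    (t₀ := j₀ + ε * r) (A := d * h' + 2 * d * p * N + p * (i + 1)) (B := 2 * d * p) hF (ρ := ρ)
    (fun s => padicToWitt p k (binomPadic p r j (N + s))) (fun s => p ^ (1 + (s + 1) / 2))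
    (fun s => p * (j + (N + s) * r : ℕ) * ρ - 1)
    (fun s => E ^ (N + s) * X ^ (p * (i + 1) - 1)) G η
    (fun s => p * (j + (N + s) * r) - r) (fun s => h' + p * (N + s)) hGη
    (fun s => by
      have h1 := congrArg (Nat.cast : ℕ → WittVector p k) (hnr s)
      rw [Nat.cast_add, Nat.cast_mul] at h1
      linear_combination (-ρ) * h1 + hρ)
    (fun s => Nat.sub_pos_of_lt (hn s)) (fun s => by rw [hnr, hτ]) hη
    (fun s => (hG s).trans (by
      rw [← hlin]
      refine max_le (Nat.le_add_right _ _) ?_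
      omega))
    (fun s => by
      rw [← hlin]
      exact (Nat.le_mul_of_pos_left _ (by omega)).trans (Nat.le_add_right _ _))
    (f := f) (by simpa only [hnr] using hf)
  exact ⟨e, g, Q, hg, hQ, hg1, by rw [hfeq, hfe]⟩

theorem exists_class_eq {F : (WittVector p k)[X]} {r d N i j ε j₀ h' : ℕ}
    (hF : F.natDegree = d) (hlc : IsUnit F.leadingCoeff) (hsep : F.Separable)
    (hε : ε = 0 ∨ ε = 1) (hN : 0 < N)
    (hi : i + 2 ≤ d) (hj : ε * r + 1 ≤ j) (hj' : j + 1 ≤ (1 + ε) * r)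
    (hj₀ : 1 ≤ j₀) (hj₀' : j₀ + 1 ≤ r)
    (hp : d * (N + ε) * r < p) (hpj : p * j = j₀ + ε * r + h' * r) (hpr : ¬ p ∣ r) :
    ∃ (e : ℕ → WittVector p k) (G : Dagger p r F),
      frobForm F hpr (xFun p r F ^ i * yInv p r F ^ j) (xFun p r F) - sparseForm p F r d N i j =
        (p : WittVector p k) ^ N • (∑ l ∈ Finset.range (d - 1),
          e l • monomialForm p F r l (j₀ + ε * r) + exteriorD p r F G) := by
  obtain ⟨ρ, hρ⟩ := (isUnit_natCast_witt (k := k) hpr).exists_right_inv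
  obtain ⟨e, g, Q, hg, hQ, hg1, hfe⟩ := exists_tail_reduction hF hlc hsep hε hN hi hj hj' hj₀ hj₀'
    hp hpj hpr hρ
  set go : overconvergentSeries p (WittVector p k) := ⟨g, hg⟩
  set Qo : overconvergentSeries p (WittVector p k) := ⟨Q, hQ⟩
  refine ⟨e, toDagger p r F go, ?_⟩
  have hgo : partialDeriv p (WittVector p k) 1 go = 0 := Subtype.ext hg1
  have hpm : ∀ (P : (WittVector p k)[X]) (n : ℕ), polyMul P n =
      ((aeval (coord p (WittVector p k) 0) P * coord p (WittVector p k) 2 ^ n :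
        overconvergentSeries p (WittVector p k)) : MvPowerSeries (Fin 3) (WittVector p k)) := by
    intro P n
    rw [polyMul, ← coe_aeval_coord]
    rfl
  simp only [hpm] at hfe
  have key : (p : overconvergentSeries p (WittVector p k)) *
      (aeval (coord p (WittVector p k) 0) (X ^ (p * (i + 1) - 1) : (WittVector p k)[X]) *
        coord p (WittVector p k) 2 ^ (j * p)) *
      (frobUnit F r (pos_of_not_dvd hpr) j - ∑ m ∈ Finset.range N, algebraMap _ _
          (padicToWitt p k (binomPadic p r j m)) * frobCorrection F r ^ m) =
      (p : overconvergentSeries p (WittVector p k)) ^ N *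
        (aeval (coord p (WittVector p k) 0) (∑ l ∈ Finset.range (d - 1), C (e l) * X ^ l) *
          coord p (WittVector p k) 2 ^ (j₀ + ε * r) +
        partialDeriv p (WittVector p k) 0 go -
        algebraMap _ _ ρ * (aeval (coord p (WittVector p k) 0) (derivative F) *
          coord p (WittVector p k) 2 ^ (r + 1)) * partialDeriv p (WittVector p k) 2 go +
        (aeval (coord p (WittVector p k) 0) F * coord p (WittVector p k) 2 ^ r - 1) * Qo) :=
    Subtype.ext hfe
  have key' := congrArg (toDagger p r F) key
  simp only [map_mul, map_add, map_sub, map_pow, map_natCast, map_one, toDagger_aeval,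
    AlgHom.commutes, aeval_X] at key'
  change _ * (xFun p r F ^ _ * yInv p r F ^ _) * _ = _ * (_ * yInv p r F ^ _ + _ -
    _ * (_ * yInv p r F ^ _) * _ + (_ * yInv p r F ^ _ - 1) * _) at key'
  -- In `A†` the relation `F(x) y^(-r) = 1` removes the whole cofactor term.
  rw [aeval_mul_yInv_pow, sub_self, zero_mul, add_zero] at key'
  rw [frobForm_eq, sparseForm_eq F hF, ← sub_smul, ← mul_sub, ← map_sub,
    exteriorD_of_partialDeriv_one_eq_zero p r F (pos_of_not_dvd hpr) hρ hgo]
  have hmono : ∑ l ∈ Finset.range (d - 1), e l • monomialForm p F r l (j₀ + ε * r) =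
      (aeval (xFun p r F) (∑ l ∈ Finset.range (d - 1), C (e l) * X ^ l) *
        yInv p r F ^ (j₀ + ε * r)) • exteriorD p r F (xFun p r F) := by
    rw [map_sum, Finset.sum_mul, Finset.sum_smul]
    refine Finset.sum_congr rfl fun l _ => ?_
    rw [monomialForm, map_mul, aeval_C, map_pow, aeval_X, mul_assoc,
      ← algebraMap_smul (Dagger p r F) (e l), smul_smul]
  rw [hmono, ← add_smul, ← algebraMap_smul (Dagger p r F) ((p : WittVector p k) ^ N), smul_smul,
    map_pow, map_natCast]
  refine congrArg (fun y => y • _) ?_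
  rw [map_sub, mul_assoc (p : Dagger p r F), key']
  ring

end Main

end CyclicCover

theorem lemma3p1 (p : ℕ) [Fact p.Prime] (k : Type*) [Field k] [Finite k] [CharP k p]
    (r d N i j : ℕ)
    (Fbar : Polynomial k) (hsq : Squarefree Fbar) (hdeg : Fbar.natDegree = d)
    (F : Polynomial (WittVector p k)) (hlift : F.map WittVector.constantCoeff = Fbar)
    (hF : F.natDegree = d)
    (hN : 0 < N) (hi : i + 2 ≤ d)
    (hj : CyclicCover.eps r d * r + 1 ≤ j) (hj' : j + 1 ≤ (1 + CyclicCover.eps r d) * r)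
    (hp : d * (N + CyclicCover.eps r d) * r < p) :
    (∃ η ∈ Submodule.span (WittVector p k)
        (CyclicCover.cohomologyClass p r F '' CyclicCover.basisForms p F r d),
      CyclicCover.cohomologyClass p r F
          (CyclicCover.frobForm F (CyclicCover.not_dvd_of_bound hN hi hj' hp)
            (CyclicCover.xFun p r F ^ i * CyclicCover.yInv p r F ^ j) (CyclicCover.xFun p r F)) -
        CyclicCover.cohomologyClass p r F (CyclicCover.sparseForm p F r d N i j) =
      (p : WittVector p k) ^ N • η) ∧
    (CyclicCover.termIndex N d).card = N + d * N.choose 2 := by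
  open CyclicCover in
  refine ⟨?_, card_termIndex N d⟩
  have hpr := not_dvd_of_bound hN hi hj' hp
  have hr : 0 < r := pos_of_not_dvd hpr
  have hε : eps r d = 0 ∨ eps r d = 1 := by
    unfold eps
    split_ifs <;> simp
  obtain ⟨j₀, h', hj₀, hj₀', hpj⟩ := exists_residue Fact.out hpr hr hj hj'
  have hdeg' : (F.map WittVector.constantCoeff).natDegree = F.natDegree := by
    rw [hlift, hdeg, hF]
  have hdp : F.natDegree < p := by
    rw [hF]
    refine lt_of_le_of_lt ?_ hp
    rw [mul_assoc]
    exact Nat.le_mul_of_pos_right d (Nat.mul_pos (by omega) hr)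
  -- Finite fields are perfect, so the squarefree residue polynomial is separable, and separability
  -- lifts.
  have hsep : F.Separable := separable_of_separable_map hdeg' (by omega) hdp
    (by rw [hlift]; exact PerfectField.separable_iff_squarefree.2 hsq)
  obtain ⟨e, G, h⟩ := exists_class_eq hF (isUnit_leadingCoeff_of_natDegree_map hdeg' (by omega))
    hsep hε hN hi hj hj' hj₀ hj₀' hp hpj hpr
  refine ⟨∑ l ∈ Finset.range (d - 1),
    e l • cohomologyClass p r F (monomialForm p F r l (j₀ + eps r d * r)), ?_, ?_⟩
  · refine Submodule.sum_mem _ fun l hl => Submodule.smul_mem _ _ (Submodule.subset_span ⟨_, ?_, rfl⟩)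
    rw [Finset.mem_range] at hl
    exact ⟨l, j₀, by omega, hj₀, hj₀', rfl⟩
  · have h0 : cohomologyClass p r F (exteriorD p r F G) = 0 := by
      rw [cohomologyClass, LinearMap.comp_apply, Submodule.mkQ_apply,
        (Submodule.Quotient.mk_eq_zero _).2 (LinearMap.mem_range_self _ G), map_zero]
    rw [← map_sub, h, map_smul, map_add, h0, add_zero, map_sum]
    simp only [map_smul]
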